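/- Let $d\ge 3$ and let $(S_n)_{n\ge 0}$ be a simple random walk on $\mathbb{Z}^d$ with $S_0=0$, defined on a probability space with probability $\mathbb{P}$, and let $\mathcal{F}_n=\sigma(S_0,\dots,S_n)$ be its standard filtration. Write $x\sim y$ when $x,y\in\mathbb{Z}^d$ are at graph distance one, $V_0=\{z: z\sim 0\}$, $\mathcal{R}_n=\{S_0,\dots,S_n\}$ (with $\mathcal{R}_{-1}=\emptyset$), $\mathcal{R}_\infty=\{S_k: k\ge 0\}$, and $$\partial\mathcal{R}_n=\{x\in\mathcal{R}_n:\ \text{there is } y\sim x \text{ with } y\notin\mathcal{R}_n\}.$$ For $V\subset V_0$, let $\mathcal{R}_{n,V}$ be the set of sites whose first visit occurs at some time $k\le n$ such that $(S_k+V_0)\cap\mathcal{R}_{k-1}^c=S_k+V$, and let $\rho_V=\mathbb{P}(V\not\subset\mathcal{R}_\infty)$ (so $\rho_\emptyset=0$). Then there are a real-valued martingale $(M_n)_{n\ge 0}$ with respect to $(\mathcal{F}_n)_{n\ge 0}$ and square-integrable random variables $\mathcal{E}_n$, $n\ge 1$, such that for every integer $n\ge 1$ $$|\partial\mathcal{R}_n|=\sum_{V\subset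 V_0}\rho_V\,|\mathcal{R}_{n-1,V}|+M_n+\mathcal{E}_n ,$$ and, for a constant $C$ that depends only on $d$, $$\mathbb{E}[\mathcal{E}_n^2]\le C\,n \ (n\ge 1)\ \text{ if } d=3,\qquad \mathbb{E}[\mathcal{E}_n^2]\le C\,\log^3 n \ (n\ge 2)\ \text{ if } d=4,\qquad \mathbb{E}[\mathcal{E}_n^2]\le C \ (n\ge 1)\ \text{ if } d\ge 5 .$$ -/

import Mathlib

open MeasureTheory ProbabilityTheory

namespace BoundaryRange

/-- Nearest-neighbour relation `x ∼ y` on the lattice `ℤ^d` (graph distance one). -/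
def Nbr {d : ℕ} (x y : Fin d → ℤ) : Prop := ∑ i, |x i - y i| = 1

instance {d : ℕ} (x y : Fin d → ℤ) : Decidable (Nbr x y) :=
  inferInstanceAs (Decidable (∑ i, |x i - y i| = 1))

/-- `V₀`, the set of the neighbours of the origin. The box `[-1,1]^d` is there only to make the set
visibly finite, see `mem_V0`. -/
noncomputable def V0 (d : ℕ) : Finset (Fin d → ℤ) :=
  {z ∈ Finset.Icc (fun _ => -1) (fun _ => 1) | Nbr z 0}

theorem mem_V0 {d : ℕ} (z : Fin d → ℤ) : z ∈ V0 d ↔ Nbr z 0 := by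
  unfold V0
  rw [Finset.mem_filter, and_iff_right_iff_imp]
  intro h
  have h1 : ∀ i, |z i| ≤ 1 := by
    intro i
    have h2 : ∑ i, |z i| = 1 := by simpa [Nbr] using h
    rw [← h2]
    exact Finset.single_le_sum (f := fun i => |z i|) (fun j _ => abs_nonneg _) (Finset.mem_univ i)
  rw [Finset.mem_Icc]
  exact ⟨fun i => (abs_le.1 (h1 i)).1, fun i => (abs_le.1 (h1 i)).2⟩

/-- `S` is a simple random walk on `ℤ^d` started at the origin, under the probability `μ`:
its increments are independent and uniform on the `2d` neighbours of the origin. -/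
structure IsSimpleRandomWalk {d : ℕ} {Ω : Type*} [MeasurableSpace Ω]
    (S : ℕ → Ω → (Fin d → ℤ)) (μ : Measure Ω) : Prop where
  measurable : ∀ n, Measurable (S n)
  start : ∀ᵐ ω ∂μ, S 0 ω = 0
  indep : iIndepFun (fun n ω => S (n + 1) ω - S n ω) μ
  step : ∀ n, ∀ z ∈ V0 d, μ.real {ω | S (n + 1) ω - S n ω = z} = 1 / (2 * d)

/-- The standard filtration `𝓕_n = σ(S_0, …, S_n)`. -/
def walkFiltration {d : ℕ} {Ω : Type*} [MeasurableSpace Ω] (S : ℕ → Ω → (Fin d → ℤ))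
    (hS : ∀ n, Measurable (S n)) : Filtration ℕ (inferInstance : MeasurableSpace Ω) :=
  Filtration.natural S fun n => (hS n).stronglyMeasurable

/-- The range `R_n = {s_0, …, s_n}` of a path `s`. -/
def walkRange {d : ℕ} (s : ℕ → (Fin d → ℤ)) (n : ℕ) : Set (Fin d → ℤ) :=
  {x | ∃ k ≤ n, s k = x}

/-- The sites `{s_0, …, s_{k-1}}` visited strictly before time `k`, that is `R_{k-1}`
(empty for `k = 0`). -/
def visitedBefore {d : ℕ} (s : ℕ → (Fin d → ℤ)) (k : ℕ) : Set (Fin d → ℤ) :=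
  {x | ∃ j < k, s j = x}

/-- The boundary `∂Λ` of a set of sites: the points of `Λ` with a neighbour outside `Λ`. -/
def boundary {d : ℕ} (Λ : Set (Fin d → ℤ)) : Set (Fin d → ℤ) :=
  {x | x ∈ Λ ∧ ∃ y, Nbr y x ∧ y ∉ Λ}

/-- `R_{n,V}`: the sites whose first visit occurs at some time `k ≤ n`, and such that
`(s_k + V₀) ∩ R_{k-1}ᶜ = s_k + V`. -/
def rangeV {d : ℕ} (s : ℕ → (Fin d → ℤ)) (n : ℕ) (V : Finset (Fin d → ℤ)) :
    Set (Fin d → ℤ) :=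
  {x | ∃ k ≤ n, s k = x ∧ s k ∉ visitedBefore s k ∧
    ((fun z => s k + z) '' (V0 d : Set (Fin d → ℤ))) ∩ (visitedBefore s k)ᶜ =
      (fun z => s k + z) '' (V : Set (Fin d → ℤ))}

/-- `ρ_V = P(V ⊄ R_∞)`, where `R_∞ = {S_0, S_1, …}`. -/
noncomputable def rho {d : ℕ} {Ω : Type*} [MeasurableSpace Ω] (S : ℕ → Ω → (Fin d → ℤ))
    (μ : Measure Ω) (V : Finset (Fin d → ℤ)) : ℝ :=
  μ.real {ω | ¬ ((V : Set (Fin d → ℤ)) ⊆ Set.range fun k => S k ω)}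

theorem rho_empty {d : ℕ} {Ω : Type*} [MeasurableSpace Ω] (S : ℕ → Ω → (Fin d → ℤ))
    (μ : Measure Ω) : rho S μ ∅ = 0 := by
  simp [rho]

/-- All the sets of sites that are counted are finite. -/
theorem walkRange_finite {d : ℕ} (s : ℕ → (Fin d → ℤ)) (n : ℕ) : (walkRange s n).Finite :=
  (Set.finite_Iic n).image s

theorem boundary_subset {d : ℕ} (Λ : Set (Fin d → ℤ)) : boundary Λ ⊆ Λ := fun _ h => h.1

theorem rangeV_subset {d : ℕ} (s : ℕ → (Fin d → ℤ)) (n : ℕ) (V : Finset (Fin d → ℤ)) :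
    rangeV s n V ⊆ walkRange s n := fun _ ⟨k, hk, h, _⟩ => ⟨k, hk, h⟩

end BoundaryRange

namespace BoundaryRange

/-! ### The neighbours of the origin -/

/-! Count each boundary site at its first visit, so that the size of the boundary is the sum over `k
≤ n` of the indicators `exposedUpTo` (new site at time `k`, with a neighbour outside `R_n`). For `k
< n`, compare this indicator with `exposedForever`, where the neighbour must never be visited. A
neighbour already visited before time `k` cannot count, so given `F_k` only the walk after time `k`
matters. By the Markov property the conditional probability is `ρ_V` on the event that the site is
new and its fresh neighbours form `V`; this is `exposureProb`, and its sum over `k < n` is the main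
term.

The compensated sum of the `exposedForever` indicators looks into the future, so it is not adapted.
Its projection on `F_n` is a martingale (`martingale_compensatedExposure`), because each new
increment has conditional mean zero. What remains is the indicator for `k = n`, at most 1, plus the
conditional expectation given `F_n` of the number of sites exposed at time `n` but completely
surrounded later (`boundaryError_ae_eq`). Such a site has a neighbour hit after time `n`, so this
expectation is at most `greenSum`, the sum over the past of Green functions seen from `S_n`
(`condExp_laterCovered_le`).

The second moment of `greenSum` is controlled by the square of `∑_{m ≤ n} heatTail d m`, since
independent increments decouple the pairs (`lintegral_greenSum_sq_le_heatTail`). The heat kernel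
bound `m^(-d/2)` gives `heatTail d m = O((m+1)^(1-d/2))`, so the sum is of order `√n`, `log n` or
`1` for `d = 3`, `d = 4`, `d ≥ 5`. For `d = 4` this even yields `log² n`. -/

theorem mem_V0_iff_exists_single {d : ℕ} (z : Fin d → ℤ) :
    z ∈ V0 d ↔ ∃ j : Fin d, z = Pi.single j 1 ∨ z = Pi.single j (-1) := by
  rw [mem_V0]
  constructor
  · intro h
    have h1 : ∑ i, |z i| = 1 := by simpa [Nbr] using h
    obtain ⟨j, hj⟩ : ∃ j, z j ≠ 0 := by
      by_contra! hc
      simp [hc] at h1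
    have hz : 1 ≤ |z j| := Int.one_le_abs hj
    rw [← Finset.add_sum_erase _ _ (Finset.mem_univ j)] at h1
    have h2 : 0 ≤ ∑ i ∈ Finset.univ.erase j, |z i| := Finset.sum_nonneg fun i _ => abs_nonneg _
    have h3 : ∑ i ∈ Finset.univ.erase j, |z i| = 0 := by linarith
    have h4 : ∀ i, i ≠ j → z i = 0 := by
      intro i hi
      have := (Finset.sum_eq_zero_iff_of_nonneg (fun i _ => abs_nonneg (z i))).1 h3 i (by simp [hi])
      simpa using this
    have h5 : |z j| = 1 := by linarith
    refine ⟨j, ?_⟩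
    rcases (abs_eq zero_le_one).1 h5 with h | h
    · left
      ext i
      by_cases hi : i = j
      · subst hi; simp [h]
      · simp [hi, h4 i hi]
    · right
      ext i
      by_cases hi : i = j
      · subst hi; simp [h]
      · simp [hi, h4 i hi]
  · rintro ⟨j, rfl | rfl⟩ <;>
    · simp only [Nbr, Pi.zero_apply, sub_zero]
      rw [Finset.sum_eq_single j]
      · simp
      · intro i _ hi
        simp [hi]
      · simp

theorem sum_V0 {d : ℕ} {A : Type*} [AddCommMonoid A] (g : (Fin d → ℤ) → A) :
    ∑ z ∈ V0 d, g z = ∑ j : Fin d, (g (Pi.single j 1) + g (Pi.single j (-1))) := by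
  classical
  have hV : V0 d = (Finset.univ ×ˢ ({1, -1} : Finset ℤ)).image
      (fun p : Fin d × ℤ => (Pi.single p.1 p.2 : Fin d → ℤ)) := by
    ext z
    rw [mem_V0_iff_exists_single]
    simp only [Finset.mem_image, Finset.mem_product, Finset.mem_univ, true_and, Finset.mem_insert,
      Finset.mem_singleton, Prod.exists]
    constructor
    · rintro ⟨j, h | h⟩
      · exact ⟨j, 1, Or.inl rfl, h.symm⟩
      · exact ⟨j, -1, Or.inr rfl, h.symm⟩
    · rintro ⟨j, b, rfl | rfl, h⟩
      · exact ⟨j, Or.inl h.symm⟩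
      · exact ⟨j, Or.inr h.symm⟩
  rw [hV, Finset.sum_image, Finset.sum_product]
  · refine Finset.sum_congr rfl fun j _ => ?_
    rw [Finset.sum_pair (by norm_num)]
  · rintro ⟨j, a⟩ ha ⟨k, b⟩ hb h
    simp only [Finset.coe_product, Set.mem_prod, Finset.mem_coe, Finset.mem_insert,
      Finset.mem_singleton] at ha hb
    have ha0 : a ≠ 0 := by rcases ha.2 with h | h <;> simp [h]
    have h1 := congrFun h j
    by_cases hjk : j = k
    · subst hjk
      simp at h1
      simp [h1]
    · simp [hjk, ha0] at h1

theorem card_V0 (d : ℕ) : (V0 d).card = 2 * d := by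
  have := sum_V0 (d := d) (fun _ => 1)
  simp only [Finset.sum_const, smul_eq_mul, mul_one, Finset.card_univ, Fintype.card_fin] at this
  omega

/-! ### The one-dimensional walk -/

/-- The law of the one-dimensional simple random walk. -/
noncomputable def lineKernel : ℕ → ℤ → ℝ
  | 0, y => if y = 0 then 1 else 0
  | n + 1, y => (lineKernel n (y - 1) + lineKernel n (y + 1)) / 2

/-- The two claims need one joint induction: Pascal's rule at the left end of the support uses that
the kernel vanishes just outside it. -/
theorem lineKernel_eq_choose (n : ℕ) :
    (∀ k : ℕ, lineKernel n (2 * k - n) = (n.choose k : ℝ) / 2 ^ n) ∧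
      ∀ y : ℤ, (∀ k : ℕ, y ≠ 2 * k - n) → lineKernel n y = 0 := by
  induction n with
  | zero =>
    constructor
    · intro k
      cases k with
      | zero => simp [lineKernel]
      | succ k =>
        have : (2 * ((k : ℤ) + 1)) ≠ 0 := by omega
        simp [lineKernel]
        omega
    · intro y hy
      have := hy 0
      simp only [lineKernel]
      rw [if_neg (by simpa using this)]
  | succ n ih =>
    constructor
    · intro k
      have h2 : (2 * (k : ℤ) - ((n + 1 : ℕ) : ℤ)) + 1 = 2 * k - n := by push_cast; ring
      cases k with
      | zero =>
        simp only [lineKernel]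
        rw [h2, ih.1, ih.2 _ (by intro k; push_cast; omega)]
        simp
        field_simp
        ring
      | succ k =>
        have h1 : (2 * ((k + 1 : ℕ) : ℤ) - ((n + 1 : ℕ) : ℤ)) - 1 = 2 * k - n := by push_cast; ring
        simp only [lineKernel]
        rw [h1, h2, ih.1, ih.1, Nat.choose_succ_succ]
        push_cast
        field_simp
        ring
    · intro y hy
      simp only [lineKernel]
      rw [ih.2, ih.2]
      · simp
      · intro k hk
        apply hy k
        push_cast
        omega
      · intro k hk
        apply hy (k + 1)
        push_cast
        omega

/-- The ratio of successive left sides is `4(2m+1)(2m+3)/(m+1)²`, which is at most 16. This replaces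
Stirling's formula. -/
theorem centralBinom_sq_mul_le (m : ℕ) : m.centralBinom ^ 2 * (2 * m + 1) ≤ 16 ^ m := by
  induction m with
  | zero => simp
  | succ m ih =>
    have h := Nat.succ_mul_centralBinom_succ m
    have hpos : 0 < (m + 1) ^ 2 := by positivity
    refine Nat.le_of_mul_le_mul_left ?_ hpos
    calc (m + 1) ^ 2 * ((m + 1).centralBinom ^ 2 * (2 * (m + 1) + 1))
        = ((m + 1) * (m + 1).centralBinom) ^ 2 * (2 * m + 3) := by ring
      _ = 4 * (2 * m + 1) * (2 * m + 3) * (m.centralBinom ^ 2 * (2 * m + 1)) := by rw [h]; ring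
      _ ≤ 4 * (2 * m + 1) * (2 * m + 3) * 16 ^ m := Nat.mul_le_mul_left _ ih
      _ ≤ (16 * (m + 1) ^ 2) * 16 ^ m := Nat.mul_le_mul_right _ (by nlinarith)
      _ = (m + 1) ^ 2 * 16 ^ (m + 1) := by ring

theorem choose_half_sq_mul_le (n : ℕ) : (n.choose (n / 2)) ^ 2 * (n + 1) ≤ 4 ^ n := by
  rcases Nat.even_or_odd' n with ⟨m, rfl | rfl⟩
  · have h := centralBinom_sq_mul_le m
    rw [Nat.centralBinom_eq_two_mul_choose] at h
    rw [Nat.mul_div_cancel_left _ (by norm_num), pow_mul]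
    exact h
  · have h := centralBinom_sq_mul_le (m + 1)
    have h2 : (2 * m + 1) / 2 = m := by omega
    have h3 : (m + 1).centralBinom = 2 * (2 * m + 1).choose m := by
      rw [Nat.centralBinom_eq_two_mul_choose, show 2 * (m + 1) = (2 * m + 1) + 1 by ring,
        Nat.choose_succ_succ, Nat.choose_symm_half]
      ring
    rw [h3] at h
    rw [h2]
    have h4 : 16 ^ (m + 1) = 4 * 4 ^ (2 * m + 1) := by
      rw [show (16 : ℕ) = 4 ^ 2 by norm_num, ← pow_mul]; ring
    rw [h4] at h
    nlinarith [sq_nonneg ((2 * m + 1).choose m)]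

theorem lineKernel_le (n : ℕ) (y : ℤ) : lineKernel n y ≤ 1 / √((n : ℝ) + 1) := by
  by_cases hy : ∃ k : ℕ, y = 2 * k - n
  · obtain ⟨k, rfl⟩ := hy
    rw [(lineKernel_eq_choose n).1 k, div_le_div_iff₀ (by positivity) (by positivity), one_mul]
    have h1 : ((n.choose k : ℕ) : ℝ) ≤ n.choose (n / 2) := by exact_mod_cast Nat.choose_le_middle k n
    have h2 : ((n.choose (n / 2) : ℕ) : ℝ) ^ 2 * (n + 1) ≤ 4 ^ n := by
      exact_mod_cast choose_half_sq_mul_le n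
    calc (n.choose k : ℝ) * √((n : ℝ) + 1) ≤ n.choose (n / 2) * √((n : ℝ) + 1) := by gcongr
      _ ≤ 2 ^ n := by
        refine abs_le_of_sq_le_sq' ?_ (by positivity) |>.2
        rw [mul_pow, Real.sq_sqrt (by positivity), ← pow_mul, mul_comm n 2, pow_mul]
        norm_num
        exact h2
  · push Not at hy
    rw [(lineKernel_eq_choose n).2 y hy]
    positivity

theorem lineKernel_nonneg (n : ℕ) (y : ℤ) : 0 ≤ lineKernel n y := by
  induction n generalizing y with
  | zero => simp only [lineKernel]; split_ifs <;> norm_num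
  | succ n ih =>
    simp only [lineKernel]
    have := ih (y - 1)
    have := ih (y + 1)
    positivity

/-! ### The heat kernel bound -/

/-- The law of `d` independent one-dimensional walks that have made `n j` steps each. -/
noncomputable def productKernel {d : ℕ} (n : Fin d → ℕ) (x : Fin d → ℤ) : ℝ :=
  ∏ j, lineKernel (n j) (x j)

/-- A uniform lattice step is a uniform choice of coordinate followed by a fair sign. Averaging over
the sign advances the clock of that coordinate by one. -/
theorem sum_V0_productKernel {d : ℕ} (n : Fin d → ℕ) (x : Fin d → ℤ) :
    1 / (2 * (d : ℝ)) * ∑ z ∈ V0 d, productKernel n (x - z) =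
      1 / (d : ℝ) * ∑ j, productKernel (Function.update n j (n j + 1)) x := by
  rw [sum_V0, Finset.mul_sum, Finset.mul_sum]
  refine Finset.sum_congr rfl fun j _ => ?_
  have h : ∀ s : ℤ, productKernel n (x - Pi.single j s) =
      lineKernel (n j) (x j - s) * ∏ i ∈ Finset.univ.erase j, lineKernel (n i) (x i) := by
    intro s
    rw [productKernel, ← Finset.mul_prod_erase _ _ (Finset.mem_univ j)]
    congr 1
    · simp
    · refine Finset.prod_congr rfl fun i hi => ?_
      simp [Finset.ne_of_mem_erase hi]
  have h' : productKernel (Function.update n j (n j + 1)) x =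
      lineKernel (n j + 1) (x j) * ∏ i ∈ Finset.univ.erase j, lineKernel (n i) (x i) := by
    rw [productKernel, ← Finset.mul_prod_erase _ _ (Finset.mem_univ j)]
    congr 1
    · simp
    · refine Finset.prod_congr rfl fun i hi => ?_
      simp [Finset.ne_of_mem_erase hi]
  rw [h, h, h']
  simp only [lineKernel, sub_neg_eq_add]
  ring

/-- The law after `i` further steps, each in a uniformly chosen coordinate direction, of walks that
have already made `n j` steps in direction `j`. -/
noncomputable def randomizedKernel {d : ℕ} (x : Fin d → ℤ) : ℕ → (Fin d → ℕ) → ℝ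
  | 0, n => productKernel n x
  | i + 1, n => 1 / (d : ℝ) * ∑ j, randomizedKernel x i (Function.update n j (n j + 1))

theorem sum_V0_randomizedKernel {d : ℕ} (i : ℕ) (n : Fin d → ℕ) (x : Fin d → ℤ) :
    1 / (2 * (d : ℝ)) * ∑ z ∈ V0 d, randomizedKernel (x - z) i n = randomizedKernel x (i + 1) n := by
  induction i generalizing n with
  | zero => exact sum_V0_productKernel n x
  | succ i ih =>
    calc _ = 1 / (2 * (d : ℝ)) * ∑ z ∈ V0 d, 1 / (d : ℝ) *
          ∑ j, randomizedKernel (x - z) i (Function.update n j (n j + 1)) := rfl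
      _ = 1 / (d : ℝ) * ∑ j, 1 / (2 * (d : ℝ)) *
          ∑ z ∈ V0 d, randomizedKernel (x - z) i (Function.update n j (n j + 1)) := by
        simp only [← Finset.mul_sum]
        rw [Finset.sum_comm]
        ring
      _ = _ := by
        rw [randomizedKernel]
        simp only [ih]

/-- For large `a` the true correction is about `1/(2a)`; giving up half of it makes the bound valid
for all `a ≥ 1`. -/
theorem sqrt_div_add_one_le {a : ℝ} (ha : 1 ≤ a) : √(a / (a + 1)) ≤ 1 - 1 / (4 * a) := by
  have h0 : (0 : ℝ) ≤ 1 - 1 / (4 * a) := by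
    rw [sub_nonneg, div_le_one (by positivity)]; linarith
  rw [Real.sqrt_le_left h0]
  have : (1 - 1 / (4 * a)) ^ 2 - a / (a + 1) = (1 / (a + 1) - 1 / (2 * a)) + (1 / (4 * a)) ^ 2 := by
    field_simp
    ring
  have h1 : 1 / (2 * a) ≤ 1 / (a + 1) := one_div_le_one_div_of_le (by positivity) (by linarith)
  nlinarith [sq_nonneg (1 / (4 * a))]

theorem exp_le_sqrt_div_add {a c : ℝ} (ha : 0 < a) (hc : 0 ≤ c) :
    Real.exp (-(c / (2 * a))) ≤ √(a / (a + c)) := by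
  refine Real.le_sqrt_of_sq_le ?_
  rw [← Real.exp_nat_mul, show ((2 : ℕ) : ℝ) * -(c / (2 * a)) = -(c / a) by push_cast; field_simp,
    Real.exp_neg, show a / (a + c) = (c / a + 1)⁻¹ by field_simp; ring]
  gcongr
  exact Real.add_one_le_exp _

/-- Both sides are compared with `exp(-(1/d) ∑ 1/(4 a_j))`, which turns an average over coordinates
into a product. The rate `1/(2d)` is half the true clock rate `1/d`, owing to the factor lost in
`sqrt_div_add_one_le`. -/
theorem mean_sqrt_le_prod_sqrt {d : ℕ} (hd : 0 < d) (a : Fin d → ℝ) (ha : ∀ j, 1 ≤ a j) :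
    1 / (d : ℝ) * ∑ j, √(a j / (a j + 1)) ≤ ∏ j, √(a j / (a j + 1 / (2 * d))) := by
  have hd' : (0 : ℝ) < d := by exact_mod_cast hd
  calc 1 / (d : ℝ) * ∑ j, √(a j / (a j + 1)) ≤ 1 / (d : ℝ) * ∑ j, (1 - 1 / (4 * a j)) := by
        gcongr with j
        exact sqrt_div_add_one_le (ha j)
    _ = -(1 / (d : ℝ) * ∑ j, 1 / (4 * a j)) + 1 := by
        rw [Finset.sum_sub_distrib]
        simp only [Finset.sum_const, Finset.card_univ, Fintype.card_fin, nsmul_eq_mul, mul_one]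
        field_simp
        ring
    _ ≤ Real.exp (-(1 / (d : ℝ) * ∑ j, 1 / (4 * a j))) := Real.add_one_le_exp _
    _ = ∏ j, Real.exp (-(1 / (2 * (d : ℝ)) / (2 * a j))) := by
        rw [← Real.exp_sum, Finset.mul_sum, ← Finset.sum_neg_distrib]
        congr 1
        refine Finset.sum_congr rfl fun j _ => ?_
        have := ha j
        have : a j ≠ 0 := by positivity
        field_simp
        norm_num
    _ ≤ _ := by
        refine Finset.prod_le_prod (fun j _ => (Real.exp_pos _).le) fun j _ => ?_
        exact exp_le_sqrt_div_add (by linarith [ha j]) (by positivity)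

/-- The bound acts as if every clock ran deterministically at rate `1/(2d)`, so no concentration
estimate for the random clocks is needed. Advancing clock `j` multiplies the product by
`√(a_j/(a_j+1))`, and `mean_sqrt_le_prod_sqrt` closes the induction. -/
theorem randomizedKernel_le {d : ℕ} (hd : 0 < d) (x : Fin d → ℤ) (i : ℕ) (n : Fin d → ℕ) :
    randomizedKernel x i n ≤ ∏ j, 1 / √((n j : ℝ) + 1 + i / (2 * d)) := by
  have hd' : (0 : ℝ) < d := by exact_mod_cast hd
  induction i generalizing n with
  | zero =>
    rw [randomizedKernel, productKernel]
    refine Finset.prod_le_prod (fun j _ => lineKernel_nonneg _ _) fun j _ => ?_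
    simpa using lineKernel_le (n j) (x j)
  | succ i ih =>
    set a : Fin d → ℝ := fun j => (n j : ℝ) + 1 + i / (2 * d) with ha
    have ha1 : ∀ j, 1 ≤ a j := by
      intro j
      have : (0 : ℝ) ≤ (n j : ℝ) + i / (2 * d) := by positivity
      simp only [ha]; linarith
    have hap : ∀ j, 0 < a j := fun j => by linarith [ha1 j]
    rw [randomizedKernel]
    have key : ∀ j, randomizedKernel x i (Function.update n j (n j + 1)) ≤
        (∏ j, 1 / √(a j)) * √(a j / (a j + 1)) := by
      intro j
      refine (ih _).trans (le_of_eq ?_)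
      rw [← Finset.mul_prod_erase _ _ (Finset.mem_univ j),
        ← Finset.mul_prod_erase _ (fun j => 1 / √(a j)) (Finset.mem_univ j)]
      have h1 : ∏ k ∈ Finset.univ.erase j,
          1 / √(((Function.update n j (n j + 1) k : ℕ) : ℝ) + 1 + i / (2 * d)) =
          ∏ k ∈ Finset.univ.erase j, 1 / √(a k) := by
        refine Finset.prod_congr rfl fun k hk => ?_
        simp [Finset.ne_of_mem_erase hk, ha]
      rw [h1]
      have h2 : ((Function.update n j (n j + 1) j : ℕ) : ℝ) + 1 + i / (2 * d) = a j + 1 := by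
        simp [ha]; ring
      rw [h2, Real.sqrt_div (hap j).le]
      have : √(a j) ≠ 0 := (Real.sqrt_pos.2 (hap j)).ne'
      field_simp
    calc 1 / (d : ℝ) * ∑ j, randomizedKernel x i (Function.update n j (n j + 1))
        ≤ 1 / (d : ℝ) * ∑ j, (∏ j, 1 / √(a j)) * √(a j / (a j + 1)) := by
          gcongr with j
          exact key j
      _ = (∏ j, 1 / √(a j)) * (1 / (d : ℝ) * ∑ j, √(a j / (a j + 1))) := by
          rw [← Finset.mul_sum]; ring
      _ ≤ (∏ j, 1 / √(a j)) * ∏ j, √(a j / (a j + 1 / (2 * d))) := by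
          have := mean_sqrt_le_prod_sqrt hd a ha1
          have h0 : 0 ≤ ∏ j, 1 / √(a j) := Finset.prod_nonneg fun j _ => by positivity
          gcongr
      _ = _ := by
          rw [← Finset.prod_mul_distrib]
          refine Finset.prod_congr rfl fun j _ => ?_
          have h3 : (n j : ℝ) + 1 + ((i + 1 : ℕ) : ℝ) / (2 * d) = a j + 1 / (2 * d) := by
            simp only [ha]; push_cast; ring
          rw [h3, Real.sqrt_div (hap j).le]
          have : √(a j) ≠ 0 := (Real.sqrt_pos.2 (hap j)).ne'
          field_simp

/-- Any solution of the forward equation of the simple random walk started from the unit mass at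
the origin decays like `m ^ (-d / 2)`, uniformly in space. -/
theorem heatKernel_le {d : ℕ} (hd : 0 < d) (f : ℕ → (Fin d → ℤ) → ℝ)
    (h0 : ∀ x, f 0 x = if x = 0 then 1 else 0)
    (hs : ∀ m x, f (m + 1) x = 1 / (2 * (d : ℝ)) * ∑ z ∈ V0 d, f m (x - z)) (m : ℕ)
    (x : Fin d → ℤ) : f m x ≤ (1 / √(1 + m / (2 * d))) ^ d := by
  have h : ∀ m x, f m x = randomizedKernel x m 0 := by
    intro m
    induction m with
    | zero =>
      intro x
      rw [h0]
      simp only [randomizedKernel, productKernel, lineKernel]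
      by_cases hx : x = 0
      · simp [hx]
      · rw [if_neg hx]
        obtain ⟨j, hj⟩ := Function.ne_iff.1 hx
        exact (Finset.prod_eq_zero (Finset.mem_univ j) (if_neg hj)).symm
    | succ m ih =>
      intro x
      rw [hs, ← sum_V0_randomizedKernel]
      simp only [ih]
  rw [h]
  refine (randomizedKernel_le hd x m 0).trans (le_of_eq ?_)
  simp

open scoped ENNReal

/-! ### The Markov property -/

section Markov

variable {d : ℕ} {Ω : Type*} [MeasurableSpace Ω] {μ : Measure Ω} {S : ℕ → Ω → (Fin d → ℤ)}

/-- The path of the walk after time `n`, translated so as to start at the origin. -/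
def shiftedWalk (S : ℕ → Ω → (Fin d → ℤ)) (n : ℕ) (ω : Ω) (l : ℕ) : Fin d → ℤ :=
  S (n + l) ω - S n ω

theorem IsSimpleRandomWalk.measurable_step (hS : IsSimpleRandomWalk S μ) (n : ℕ) :
    Measurable fun ω => S (n + 1) ω - S n ω :=
  (hS.measurable _).sub (hS.measurable _)

theorem IsSimpleRandomWalk.measurable_shiftedWalk (hS : IsSimpleRandomWalk S μ) (n : ℕ) :
    Measurable (shiftedWalk S n) :=
  measurable_pi_lambda _ fun _ => (hS.measurable _).sub (hS.measurable _)

theorem IsSimpleRandomWalk.measure_step [IsProbabilityMeasure μ] (hS : IsSimpleRandomWalk S μ)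
    (hd : 0 < d) (n : ℕ) (z : Fin d → ℤ) :
    μ.real {ω | S (n + 1) ω - S n ω = z} = if z ∈ V0 d then 1 / (2 * (d : ℝ)) else 0 := by
  split_ifs with hz
  · exact hS.step n z hz
  · have hd' : (0 : ℝ) < d := by exact_mod_cast hd
    have hm : ∀ z, MeasurableSet {ω | S (n + 1) ω - S n ω = z} := fun z =>
      hS.measurable_step n (measurableSet_singleton z)
    have h1 : μ.real (⋃ y ∈ V0 d, {ω | S (n + 1) ω - S n ω = y}) = 1 := by
      rw [measureReal_biUnion_finset, Finset.sum_congr rfl (hS.step n)]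
      · simp [card_V0]
        field_simp
      · intro a _ b _ hab
        exact Set.disjoint_left.2 fun ω h1 h2 => hab (h1.symm.trans h2)
      · exact fun y _ => hm y
    have h2 : Disjoint {ω | S (n + 1) ω - S n ω = z} (⋃ y ∈ V0 d, {ω | S (n + 1) ω - S n ω = y}) := by
      refine Set.disjoint_left.2 fun ω (h1 : _ = z) h2 => ?_
      simp only [Set.mem_iUnion, Set.mem_ofPred_eq, exists_prop] at h2
      obtain ⟨y, hy, h3⟩ := h2
      exact hz (h1 ▸ h3 ▸ hy)
    have h3 := measureReal_union (μ := μ) h2 (Finset.measurableSet_biUnion _ fun y _ => hm y)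
      (measure_ne_top _ _) (measure_ne_top _ _)
    have h4 : μ.real ({ω | S (n + 1) ω - S n ω = z} ∪
      (⋃ y ∈ V0 d, {ω | S (n + 1) ω - S n ω = y})) ≤ 1 := measureReal_le_one
    have h5 : 0 ≤ μ.real {ω | S (n + 1) ω - S n ω = z} := measureReal_nonneg
    linarith

theorem IsSimpleRandomWalk.map_step_eq [IsProbabilityMeasure μ] (hS : IsSimpleRandomWalk S μ)
    (hd : 0 < d) (n : ℕ) :
    μ.map (fun ω => S (n + 1) ω - S n ω) = μ.map (fun ω => S (0 + 1) ω - S 0 ω) := by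
  refine Measure.ext_of_singleton fun z => ?_
  rw [Measure.map_apply (hS.measurable_step n) (measurableSet_singleton z),
    Measure.map_apply (hS.measurable_step 0) (measurableSet_singleton z)]
  have h := (hS.measure_step hd n z).trans (hS.measure_step hd 0 z).symm
  exact (measureReal_eq_measureReal_iff).1 h

/-- Partial sums of a sequence of increments. -/
def pathOfSteps (ζ : ℕ → Fin d → ℤ) (l : ℕ) : Fin d → ℤ := ∑ i ∈ Finset.range l, ζ i

theorem measurable_pathOfSteps_of_lt {X : ℕ → Ω → Fin d → ℤ} (n : ℕ)
    (hX : ∀ j < n, Measurable (X j)) :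
    Measurable fun ω (i : Fin (n + 1)) => pathOfSteps (fun j => X j ω) i := by
  refine measurable_pi_lambda _ fun i => Finset.measurable_fun_sum _ fun j hj => hX j ?_
  have := Finset.mem_range.1 hj
  omega

theorem measurable_pathOfSteps : Measurable (pathOfSteps (d := d)) :=
  measurable_pi_lambda _ fun _ => Finset.measurable_fun_sum _ fun i _ => measurable_pi_apply i

omit [MeasurableSpace Ω] in
theorem shiftedWalk_eq_pathOfSteps (n : ℕ) (ω : Ω) :
    shiftedWalk S n ω = pathOfSteps fun i => S (n + i + 1) ω - S (n + i) ω := by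
  funext l
  have := Finset.sum_range_sub (fun i => S (n + i) ω) l
  simp only [shiftedWalk, pathOfSteps]
  rw [add_zero] at this
  exact this.symm

theorem IsSimpleRandomWalk.map_steps_eq [IsProbabilityMeasure μ] (hS : IsSimpleRandomWalk S μ)
    (hd : 0 < d) (n : ℕ) :
    μ.map (fun ω i => S (n + i + 1) ω - S (n + i) ω) =
      μ.map (fun ω i => S (0 + i + 1) ω - S (0 + i) ω) := by
  have h : ∀ n, μ.map (fun ω i => S (n + i + 1) ω - S (n + i) ω) =
      Measure.infinitePi (fun _ : ℕ => μ.map (fun ω => S (0 + 1) ω - S 0 ω)) := by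
    intro n
    have h1 := (hS.indep.precomp (g := fun i => n + i) (add_right_injective n))
    rw [h1.map_fun_eq_infinitePi_map fun i => hS.measurable_step (n + i)]
    congr 1
    funext i
    exact hS.map_step_eq hd (n + i)
  rw [h n, h 0]

theorem IsSimpleRandomWalk.map_shiftedWalk [IsProbabilityMeasure μ] (hS : IsSimpleRandomWalk S μ)
    (hd : 0 < d) (n : ℕ) : μ.map (shiftedWalk S n) = μ.map (fun ω l => S l ω) := by
  have hm : ∀ n, Measurable (fun ω i => S (n + i + 1) ω - S (n + i) ω) := fun n =>
    measurable_pi_lambda _ fun i => hS.measurable_step (n + i)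
  have h1 : ∀ n, μ.map (shiftedWalk S n) =
      (μ.map (fun ω i => S (n + i + 1) ω - S (n + i) ω)).map pathOfSteps := by
    intro n
    rw [Measure.map_map measurable_pathOfSteps (hm n)]
    congr 1
    funext ω
    exact shiftedWalk_eq_pathOfSteps n ω
  have h2 : μ.map (shiftedWalk S 0) = μ.map (fun ω l => S l ω) := by
    refine Measure.map_congr ?_
    filter_upwards [hS.start] with ω hω
    funext l
    simp [shiftedWalk, hω]
  rw [h1 n, hS.map_steps_eq hd n, ← h1 0, h2]

/-- The steps up to time `n` are independent of the walk after time `n`. -/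
theorem IsSimpleRandomWalk.indep_steps_shiftedWalk (hS : IsSimpleRandomWalk S μ) (n : ℕ) :
    Indep (⨆ i ∈ Set.Iio n, MeasurableSpace.comap (fun ω => S (i + 1) ω - S i ω) inferInstance)
      (MeasurableSpace.comap (shiftedWalk S n) inferInstance) μ := by
  have h1 : Indep
      (⨆ i ∈ Set.Iio n, MeasurableSpace.comap (fun ω => S (i + 1) ω - S i ω) inferInstance)
      (⨆ i ∈ Set.Ici n, MeasurableSpace.comap (fun ω => S (i + 1) ω - S i ω) inferInstance) μ :=
    indep_iSup_of_disjoint (fun i => (hS.measurable_step i).comap_le) hS.indep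
      (Set.disjoint_left.2 fun i hi hi' => absurd (Set.mem_Iio.1 hi) (not_lt.2 hi'))
  refine indep_of_indep_of_le_right h1 (Measurable.comap_le ?_)
  rw [funext fun ω => shiftedWalk_eq_pathOfSteps (S := S) n ω]
  refine measurable_pathOfSteps.comp (@measurable_pi_lambda _ _ _ (_) _ _ fun i => ?_)
  refine Measurable.mono (comap_measurable _) (le_iSup₂_of_le (n + i) ?_ le_rfl) le_rfl
  simp

/-- The path of the walk up to time `n`. -/
def history (S : ℕ → Ω → (Fin d → ℤ)) (n : ℕ) (ω : Ω) (i : Fin (n + 1)) : Fin d → ℤ := S i ω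

theorem walkFiltration_eq_comap (hS : ∀ n, Measurable (S n)) (n : ℕ) :
    walkFiltration S hS n = MeasurableSpace.comap (history S n) inferInstance := by
  apply le_antisymm
  · refine iSup₂_le fun j hj => Measurable.comap_le ?_
    have : S j = (fun h : Fin (n + 1) → Fin d → ℤ => h ⟨j, by omega⟩) ∘ history S n := rfl
    rw [this]
    refine Measurable.comp (measurable_pi_apply _) (comap_measurable _)
  · refine Measurable.comap_le (@measurable_pi_lambda _ _ _ (_) _ _ fun i => ?_)
    exact Measurable.mono (comap_measurable _) (le_iSup₂_of_le (i : ℕ) (by omega) le_rfl) le_rfl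

theorem measurable_walkFiltration_of_history {β : Type*} [MeasurableSpace β]
    (hS : ∀ n, Measurable (S n)) (n : ℕ) {f : Ω → β} (g : (Fin (n + 1) → Fin d → ℤ) → β)
    (hf : ∀ ω, f ω = g (history S n ω)) : Measurable[walkFiltration S hS n] f := by
  rw [walkFiltration_eq_comap hS, funext hf]
  exact (measurable_of_countable g).comp (comap_measurable _)

/-- The Markov property of the simple random walk. -/
theorem IsSimpleRandomWalk.measure_inter_shiftedWalk [IsProbabilityMeasure μ]
    (hS : IsSimpleRandomWalk S μ) (hd : 0 < d) (n : ℕ) {s : Set Ω}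
    (hs : MeasurableSet[walkFiltration S hS.measurable n] s) {A : Set (ℕ → Fin d → ℤ)}
    (hA : MeasurableSet A) :
    μ (s ∩ shiftedWalk S n ⁻¹' A) = μ s * μ {ω | (fun l => S l ω) ∈ A} := by
  rw [walkFiltration_eq_comap] at hs
  obtain ⟨T, hT, rfl⟩ := hs
  -- `S 0` belongs to the filtration but is not a function of the increments. It vanishes only
  -- almost surely, so the history is replaced by the partial sums of the steps, up to a null set.
  set h' : Ω → Fin (n + 1) → Fin d → ℤ :=
    fun ω i => pathOfSteps (fun j => S (j + 1) ω - S j ω) i with hh'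
  have hae : history S n =ᵐ[μ] h' := by
    filter_upwards [hS.start] with ω hω
    funext i
    have := congrFun (shiftedWalk_eq_pathOfSteps (S := S) 0 ω) i
    simp only [shiftedWalk, hω, zero_add, sub_zero] at this
    exact this
  have hs' : MeasurableSet[⨆ i ∈ Set.Iio n,
      MeasurableSpace.comap (fun ω => S (i + 1) ω - S i ω) inferInstance] (h' ⁻¹' T) := by
    refine @measurable_pathOfSteps_of_lt d _ (_) (fun j ω => S (j + 1) ω - S j ω) n
      (fun j hj => ?_) T hT
    exact Measurable.mono (comap_measurable _) (le_iSup₂_of_le j hj le_rfl) le_rfl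
  have hsT : (history S n ⁻¹' T : Set Ω) =ᵐ[μ] (h' ⁻¹' T : Set Ω) := hae.preimage T
  have hsA : μ (history S n ⁻¹' T ∩ shiftedWalk S n ⁻¹' A) =
      μ (h' ⁻¹' T ∩ shiftedWalk S n ⁻¹' A) :=
    measure_congr (ae_eq_set_inter hsT (ae_eq_refl _))
  rw [hsA, measure_congr hsT,
    (Indep_iff _ _ μ).1 (hS.indep_steps_shiftedWalk n) _ _ hs' ⟨A, hA, rfl⟩]
  congr 1
  rw [← Measure.map_apply (hS.measurable_shiftedWalk n) hA, hS.map_shiftedWalk hd,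
    Measure.map_apply (measurable_pi_lambda _ fun l => hS.measurable l) hA]
  rfl

theorem IsSimpleRandomWalk.measure_inter_shiftedWalk_eq [IsProbabilityMeasure μ]
    (hS : IsSimpleRandomWalk S μ) (hd : 0 < d) (n l : ℕ) {s : Set Ω}
    (hs : MeasurableSet[walkFiltration S hS.measurable n] s) (x : Fin d → ℤ) :
    μ (s ∩ {ω | S (n + l) ω - S n ω = x}) = μ s * μ {ω | S l ω = x} :=
  hS.measure_inter_shiftedWalk hd n hs (A := {w | w l = x})
    (by exact (measurable_pi_apply (X := fun _ => Fin d → ℤ) l) (measurableSet_singleton x))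

theorem IsSimpleRandomWalk.measure_sub_eq [IsProbabilityMeasure μ]
    (hS : IsSimpleRandomWalk S μ) (hd : 0 < d) (n l : ℕ) (x : Fin d → ℤ) :
    μ {ω | S (n + l) ω - S n ω = x} = μ {ω | S l ω = x} := by
  simpa using hS.measure_inter_shiftedWalk_eq hd n l MeasurableSet.univ x

/-- Integration of a functional of the past and of an increment of the future. -/
theorem IsSimpleRandomWalk.lintegral_comp_sub [IsProbabilityMeasure μ]
    (hS : IsSimpleRandomWalk S μ) (hd : 0 < d) (n l : ℕ) (f : Ω → (Fin d → ℤ) → ℝ≥0∞)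
    (hf : ∀ x, Measurable[walkFiltration S hS.measurable n] fun ω => f ω x) :
    ∫⁻ ω, f ω (S (n + l) ω - S n ω) ∂μ = ∑' x, μ {ω | S l ω = x} * ∫⁻ ω, f ω x ∂μ := by
  have hm : ∀ x, MeasurableSet {ω | S (n + l) ω - S n ω = x} := fun x =>
    ((hS.measurable _).sub (hS.measurable _)) (measurableSet_singleton x)
  have hf' : ∀ x, Measurable fun ω => f ω x := fun x => (hf x).mono
    ((walkFiltration S hS.measurable).le n) le_rfl
  have h1 : ∀ ω, f ω (S (n + l) ω - S n ω) =
      ∑' x, f ω x * {ω | S (n + l) ω - S n ω = x}.indicator (fun _ => 1) ω := by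
    intro ω
    rw [tsum_eq_single (S (n + l) ω - S n ω)]
    · simp
    · intro x hx
      simp [Set.indicator, Ne.symm hx]
  simp_rw [h1]
  rw [lintegral_tsum fun x => by
    exact ((hf' x).mul (measurable_const.indicator (hm x))).aemeasurable]
  refine tsum_congr fun x => ?_
  rw [lintegral_mul_indicator_eq_lintegral_mul_lintegral_indicator
    ((walkFiltration S hS.measurable).le n) 1 (hm x) ?_ (hf x)]
  · rw [lintegral_indicator_const (hm x), one_mul, hS.measure_sub_eq hd, mul_comm]
  · rw [IndepSets_iff]
    rintro s t hs rfl
    rw [hS.measure_inter_shiftedWalk_eq hd n l hs, hS.measure_sub_eq hd]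

/-! ### The Green function -/

/-- The Chapman–Kolmogorov equation. -/
theorem IsSimpleRandomWalk.tsum_measure_mul [IsProbabilityMeasure μ]
    (hS : IsSimpleRandomWalk S μ) (hd : 0 < d) (m l : ℕ) (w : Fin d → ℤ) :
    ∑' x, μ {ω | S l ω = x} * μ {ω | S m ω = w - x} = μ {ω | S (m + l) ω = w} := by
  have h := hS.lintegral_comp_sub hd m l (fun ω x => {ω | S m ω = w - x}.indicator 1 ω) ?_
  · have hm : ∀ x, MeasurableSet {ω | S m ω = w - x} := fun x =>
      hS.measurable m (measurableSet_singleton _)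
    simp_rw [lintegral_indicator_one (hm _)] at h
    have hw : MeasurableSet {ω | S (m + l) ω = w} :=
      hS.measurable (m + l) (measurableSet_singleton w)
    rw [← h, ← lintegral_indicator_one hw]
    refine lintegral_congr fun ω => ?_
    simp only [Set.indicator, Set.mem_ofPred_eq]
    congr 1
    rw [eq_iff_iff, eq_sub_iff_add_eq, add_sub_cancel]
  · intro x
    refine measurable_walkFiltration_of_history hS.measurable m
      (fun h => {h : Fin (m + 1) → Fin d → ℤ | h (Fin.last m) = w - x}.indicator 1 h) ?_
    intro ω
    simp only [Set.indicator, history, Set.mem_ofPred_eq, Fin.val_last]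
    rfl

/-- The heat kernel bound for the simple random walk. -/
theorem IsSimpleRandomWalk.measureReal_eq_le [IsProbabilityMeasure μ]
    (hS : IsSimpleRandomWalk S μ) (hd : 0 < d) (m : ℕ) (x : Fin d → ℤ) :
    μ.real {ω | S m ω = x} ≤ (1 / √(1 + m / (2 * d))) ^ d := by
  refine heatKernel_le hd (fun m x => μ.real {ω | S m ω = x}) ?_ ?_ m x
  · intro x
    have : μ.real {ω | S 0 ω = x} = μ.real {ω : Ω | (0 : Fin d → ℤ) = x} := by
      refine measureReal_congr ?_
      filter_upwards [hS.start] with ω hω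
      simp only [eq_iff_iff]
      change S 0 ω = x ↔ 0 = x
      rw [hω]
    rw [this]
    by_cases hx : x = 0
    · simp [hx]
    · simp [hx, Ne.symm hx]
  · intro m x
    have h := hS.tsum_measure_mul hd m 1 x
    have h1 : ∀ z, μ {ω | S 1 ω = z} = ENNReal.ofReal (if z ∈ V0 d then 1 / (2 * (d : ℝ)) else 0) := by
      intro z
      rw [← hS.measure_step hd 0 z, ofReal_measureReal, ← hS.measure_sub_eq hd 0 1 z]
    rw [tsum_eq_sum (s := V0 d)] at h
    · rw [Measure.real, ← h, ENNReal.toReal_sum, Finset.mul_sum]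
      · refine Finset.sum_congr rfl fun z hz => ?_
        rw [ENNReal.toReal_mul, h1, if_pos hz, ENNReal.toReal_ofReal (by positivity)]
        rfl
      · intro z _
        exact ENNReal.mul_ne_top (measure_ne_top _ _) (measure_ne_top _ _)
    · intro z hz
      rw [h1, if_neg hz]
      simp

end Markov

/-! ### Elementary sums -/

/-- A discrete derivative estimate, so that tails telescope. The condition `1/2 ≤ s` reduces it to
the square root case `sqrt_div_add_one_le`, which supplies the factor 4. -/
theorem rpow_neg_add_one_le {x s : ℝ} (hx : 1 ≤ x) (hs : 1 / 2 ≤ s) :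
    x ^ (-(s + 1)) ≤ 4 * (x ^ (-s) - (x + 1) ^ (-s)) := by
  have hx0 : 0 < x := by linarith
  have h1 : (x + 1) ^ (-s) = x ^ (-s) * (x / (x + 1)) ^ s := by
    rw [Real.div_rpow hx0.le (by linarith), Real.rpow_neg hx0.le, Real.rpow_neg (by linarith)]
    have : x ^ s ≠ 0 := (Real.rpow_pos_of_pos hx0 s).ne'
    field_simp
  have h2 : (x / (x + 1)) ^ s ≤ 1 - 1 / (4 * x) := by
    refine le_trans ?_ (sqrt_div_add_one_le hx)
    rw [Real.sqrt_eq_rpow]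
    refine Real.rpow_le_rpow_of_exponent_ge (by positivity) ?_ hs
    rw [div_le_one (by linarith)]
    linarith
  have h3 : x ^ (-(s + 1)) = x ^ (-s) * x⁻¹ := by
    rw [neg_add, Real.rpow_add hx0, Real.rpow_neg_one]
  have h4 : 0 < x ^ (-s) := Real.rpow_pos_of_pos hx0 _
  rw [h1, h3]
  have h5 : x ^ (-s) * (x / (x + 1)) ^ s ≤ x ^ (-s) * (1 - 1 / (4 * x)) := by gcongr
  have h6 : x ^ (-s) * (1 - 1 / (4 * x)) = x ^ (-s) - x ^ (-s) * x⁻¹ / 4 := by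
    field_simp
  linarith

theorem sum_rpow_neg_add_one_le {x s : ℝ} (hx : 1 ≤ x) (hs : 1 / 2 ≤ s) (n : ℕ) :
    ∑ l ∈ Finset.range n, (x + l) ^ (-(s + 1)) ≤ 4 * x ^ (-s) := by
  have h : ∑ l ∈ Finset.range n, (x + l) ^ (-(s + 1)) ≤ 4 * (x ^ (-s) - (x + n) ^ (-s)) := by
    induction n with
    | zero => simp
    | succ n ih =>
      rw [Finset.sum_range_succ]
      have hn : (0 : ℝ) ≤ n := n.cast_nonneg
      have := rpow_neg_add_one_le (x := x + n) (by linarith) hs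
      push_cast
      rw [← add_assoc]
      linarith
  have : 0 ≤ (x + n) ^ (-s) := Real.rpow_nonneg (by positivity) _
  linarith

/-- This sum and the next two treat the exponent `d/2 - 1` for `d = 3`, `d = 4` and `d ≥ 5`. -/
theorem sum_rpow_neg_half_le (n : ℕ) :
    ∑ m ∈ Finset.range n, ((m : ℝ) + 1) ^ (-(1 / 2 : ℝ)) ≤ 2 * √n := by
  induction n with
  | zero => simp
  | succ n ih =>
    rw [Finset.sum_range_succ, Real.rpow_neg (by positivity), ← Real.sqrt_eq_rpow]
    push_cast
    have h0 : 0 < √((n : ℝ) + 1) := Real.sqrt_pos.2 (by positivity)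
    have h1 : √((n : ℝ) + 1) ^ 2 = n + 1 := Real.sq_sqrt (by positivity)
    have h2 : √(n : ℝ) ^ 2 = n := Real.sq_sqrt (by positivity)
    have h3 : (√((n : ℝ) + 1))⁻¹ ≤ 2 * √((n : ℝ) + 1) - 2 * √n := by
      rw [inv_le_iff_one_le_mul₀ h0]
      nlinarith [sq_nonneg (√((n : ℝ) + 1) - √n)]
    linarith

theorem sum_rpow_neg_one_le (n : ℕ) :
    ∑ m ∈ Finset.range n, ((m : ℝ) + 1) ^ (-(1 : ℝ)) ≤ 1 + Real.log n := by
  have h := harmonic_le_one_add_log n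
  rw [harmonic] at h
  push_cast at h
  simpa [Real.rpow_neg_one] using h

theorem sum_rpow_neg_le_four {s : ℝ} (hs : 3 / 2 ≤ s) (n : ℕ) :
    ∑ m ∈ Finset.range n, ((m : ℝ) + 1) ^ (-s) ≤ 4 := by
  have h := sum_rpow_neg_add_one_le (x := 1) (s := 1 / 2) le_rfl le_rfl n
  rw [Real.one_rpow, mul_one] at h
  refine le_trans (Finset.sum_le_sum fun m _ => ?_) h
  rw [add_comm]
  refine Real.rpow_le_rpow_of_exponent_le ?_ (by linarith)
  have : (0 : ℝ) ≤ m := m.cast_nonneg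
  linarith

theorem sq_sum_range_le (a : ℕ → ℝ≥0∞) (n : ℕ) :
    (∑ k ∈ Finset.range n, a k) ^ 2 ≤
      2 * ∑ k ∈ Finset.range n, ∑ j ∈ Finset.range (k + 1), a j * a k := by
  induction n with
  | zero => simp
  | succ n ih =>
    rw [Finset.sum_range_succ, Finset.sum_range_succ (n := n), add_sq, mul_add 2 (∑ k ∈ _, _),
      Finset.sum_range_succ (fun j => a j * a n), ← Finset.sum_mul, mul_add 2, ← mul_assoc 2,
      ← add_assoc]
    refine add_le_add (add_le_add ih le_rfl) ?_
    rw [sq, two_mul]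
    exact le_self_add

/-! ### The second moment of the sum of Green functions -/

section SecondMoment

variable {d : ℕ} {Ω : Type*} [MeasurableSpace Ω] {μ : Measure Ω} {S : ℕ → Ω → (Fin d → ℤ)}

/-- The Green function of the walk. -/
noncomputable def green (S : ℕ → Ω → (Fin d → ℤ)) (μ : Measure Ω) (x : Fin d → ℤ) : ℝ≥0∞ :=
  ∑' l, μ {ω | S l ω = x}

/-- The Green function summed over the neighbours of a site. -/
noncomputable def greenNbr (S : ℕ → Ω → (Fin d → ℤ)) (μ : Measure Ω) (x : Fin d → ℤ) : ℝ≥0∞ :=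
  ∑ z ∈ V0 d, green S μ (x + z)

/-- A uniform bound on the expected number of visits to a site after time `m`. -/
noncomputable def heatTail (d m : ℕ) : ℝ≥0∞ :=
  ∑' l : ℕ, ENNReal.ofReal ((1 / √(1 + ((m + l : ℕ) : ℝ) / (2 * d))) ^ d)

/-- Here transience enters: `d ≥ 3` makes the tail of `l^(-d/2)` summable, with `s = d/2 - 1 ≥ 1/2`.
-/
theorem heatTail_le {d : ℕ} (hd : 3 ≤ d) (m : ℕ) :
    heatTail d m ≤ ENNReal.ofReal
      (4 * (2 * (d : ℝ)) ^ ((d : ℝ) / 2) * ((m : ℝ) + 1) ^ (-((d : ℝ) / 2 - 1))) := by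
  have hd3 : (3 : ℝ) ≤ d := by exact_mod_cast hd
  refine ENNReal.tsum_le_of_sum_range_le fun n => ?_
  rw [← ENNReal.ofReal_sum_of_nonneg fun _ _ => by positivity]
  refine ENNReal.ofReal_le_ofReal ?_
  have h1 : ∀ l : ℕ, (1 / √(1 + ((m + l : ℕ) : ℝ) / (2 * d))) ^ d ≤
      (2 * (d : ℝ)) ^ ((d : ℝ) / 2) * ((m + 1 : ℝ) + l) ^ (-(((d : ℝ) / 2 - 1) + 1)) := by
    intro l
    have h2 : (((m : ℝ) + 1) + l) / (2 * d) ≤ 1 + ((m + l : ℕ) : ℝ) / (2 * d) := by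
      have : 1 / (2 * (d : ℝ)) ≤ 1 := by rw [div_le_one (by positivity)]; linarith
      push_cast
      rw [show ((m : ℝ) + 1 + l) / (2 * d) = 1 / (2 * d) + (m + l) / (2 * d) by ring]
      linarith
    have h3 : (0 : ℝ) < ((m : ℝ) + 1) + l := by positivity
    rw [sub_add_cancel, Real.rpow_neg h3.le, ← div_eq_mul_inv,
      ← Real.div_rpow (by positivity) h3.le, Real.sqrt_eq_rpow, one_div, ← Real.inv_rpow (by positivity),
      ← Real.rpow_mul_natCast (by positivity), show (1 / 2 : ℝ) * d = d / 2 by ring]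
    refine Real.rpow_le_rpow (by positivity) ?_ (by positivity)
    rw [← inv_div (((m : ℝ) + 1) + l) (2 * d)]
    exact inv_anti₀ (by positivity) h2
  refine (Finset.sum_le_sum fun l _ => h1 l).trans ?_
  rw [← Finset.mul_sum]
  have h4 := sum_rpow_neg_add_one_le (x := (m : ℝ) + 1) (s := (d : ℝ) / 2 - 1)
    (by have : (0 : ℝ) ≤ m := m.cast_nonneg
        linarith) (by linarith) n
  calc _ ≤ (2 * (d : ℝ)) ^ ((d : ℝ) / 2) * (4 * ((m : ℝ) + 1) ^ (-((d : ℝ) / 2 - 1))) := by gcongr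
    _ = _ := by ring

/-- By Chapman–Kolmogorov, averaging the Green function over `m` steps leaves only the visits from
time `m` on. Uniformity in `w` is what later decouples two factors. -/
theorem IsSimpleRandomWalk.lintegral_green_le [IsProbabilityMeasure μ]
    (hS : IsSimpleRandomWalk S μ) (hd : 0 < d) (k m : ℕ) (w : Fin d → ℤ) :
    ∫⁻ ω, green S μ (w - (S (k + m) ω - S k ω)) ∂μ ≤ heatTail d m := by
  rw [hS.lintegral_comp_sub hd k m (fun _ x => green S μ (w - x)) fun x => measurable_const]
  simp only [lintegral_const, measure_univ, mul_one, green]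
  simp_rw [← ENNReal.tsum_mul_left]
  rw [ENNReal.tsum_comm]
  refine ENNReal.tsum_le_tsum fun l => ?_
  rw [hS.tsum_measure_mul hd l m w, ← ofReal_measureReal, add_comm l m]
  exact ENNReal.ofReal_le_ofReal (hS.measureReal_eq_le hd _ _)

theorem IsSimpleRandomWalk.lintegral_greenNbr_le [IsProbabilityMeasure μ]
    (hS : IsSimpleRandomWalk S μ) (hd : 0 < d) (k m : ℕ) (w : Fin d → ℤ) :
    ∫⁻ ω, greenNbr S μ (w - (S (k + m) ω - S k ω)) ∂μ ≤ 2 * d * heatTail d m := by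
  simp only [greenNbr]
  rw [lintegral_finsetSum]
  · calc _ ≤ ∑ z ∈ V0 d, heatTail d m := by
          refine Finset.sum_le_sum fun z _ => ?_
          simp_rw [sub_add_eq_add_sub]
          exact hS.lintegral_green_le hd k m (w + z)
      _ = _ := by simp [card_V0]
  · intro z _
    exact (measurable_of_countable fun x => green S μ (w - x + z)).comp
      ((hS.measurable _).sub (hS.measurable _))

/-- Fix the last increment `y` over `l` steps. The first factor then depends on the independent
increment over `m` steps, shifted by `-y`, and is bounded uniformly in `y`; integrating the second
factor over `y` gives the other tail. -/
theorem IsSimpleRandomWalk.lintegral_greenNbr_mul_le [IsProbabilityMeasure μ]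
    (hS : IsSimpleRandomWalk S μ) (hd : 0 < d) (j m l : ℕ) :
    ∫⁻ ω, greenNbr S μ (S j ω - S (j + m + l) ω) * greenNbr S μ (S (j + m) ω - S (j + m + l) ω) ∂μ ≤
      (2 * d * heatTail d m) * (2 * d * heatTail d l) := by
  have h := hS.lintegral_comp_sub hd (j + m) l
    (fun ω y => greenNbr S μ (-y - (S (j + m) ω - S j ω)) * greenNbr S μ (0 - y)) ?_
  · have h1 : ∀ ω, greenNbr S μ (S j ω - S (j + m + l) ω) *
        greenNbr S μ (S (j + m) ω - S (j + m + l) ω) =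
        greenNbr S μ (-(S (j + m + l) ω - S (j + m) ω) - (S (j + m) ω - S j ω)) *
          greenNbr S μ (0 - (S (j + m + l) ω - S (j + m) ω)) := by
      intro ω
      congr 2 <;> abel
    simp_rw [h1]
    rw [h]
    have h2 : ∀ y : Fin d → ℤ, Measurable fun ω => greenNbr S μ (-y - (S (j + m) ω - S j ω)) :=
      fun y => (measurable_of_countable fun x => greenNbr S μ (-y - x)).comp
        ((hS.measurable _).sub (hS.measurable _))
    simp_rw [lintegral_mul_const _ (h2 _)]
    calc _ ≤ ∑' x, μ {ω | S l ω = x} * ((2 * d * heatTail d m) * greenNbr S μ (0 - x)) := by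
          refine ENNReal.tsum_le_tsum fun x => ?_
          gcongr
          exact hS.lintegral_greenNbr_le hd j m (-x)
      _ = (2 * d * heatTail d m) * ∑' x, μ {ω | S l ω = x} * greenNbr S μ (0 - x) := by
          rw [← ENNReal.tsum_mul_left]
          exact tsum_congr fun x => by ring
      _ ≤ _ := by
          gcongr
          have h3 := hS.lintegral_comp_sub hd (j + m) l (fun _ x => greenNbr S μ (0 - x))
            fun x => measurable_const
          simp only [lintegral_const, measure_univ, mul_one] at h3
          rw [← h3]
          exact hS.lintegral_greenNbr_le hd (j + m) l 0
  · intro y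
    refine measurable_walkFiltration_of_history hS.measurable (j + m)
      (fun h => greenNbr S μ (-y - (h (Fin.last _) - h ⟨j, by omega⟩)) * greenNbr S μ (0 - y)) ?_
    intro ω
    rfl

/-- The sum over the past of the Green functions seen from the present position. -/
noncomputable def greenSum (S : ℕ → Ω → (Fin d → ℤ)) (μ : Measure Ω) (n : ℕ) (ω : Ω) : ℝ≥0∞ :=
  ∑ k ∈ Finset.range n, greenNbr S μ (S k ω - S n ω)

theorem IsSimpleRandomWalk.lintegral_greenSum_sq_le_heatTail [IsProbabilityMeasure μ]
    (hS : IsSimpleRandomWalk S μ) (hd : 0 < d) (n : ℕ) :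
    ∫⁻ ω, greenSum S μ n ω ^ 2 ∂μ ≤
      2 * (2 * d * ∑ m ∈ Finset.range (n + 1), heatTail d m) ^ 2 := by
  have hm : ∀ k, Measurable fun ω => greenNbr S μ (S k ω - S n ω) := fun k =>
    (measurable_of_countable (greenNbr S μ)).comp ((hS.measurable _).sub (hS.measurable _))
  have hm2 : ∀ j k, Measurable fun ω =>
      greenNbr S μ (S j ω - S n ω) * greenNbr S μ (S k ω - S n ω) := fun j k => (hm j).mul (hm k)
  set B := ∑ m ∈ Finset.range (n + 1), heatTail d m with hB
  calc ∫⁻ ω, greenSum S μ n ω ^ 2 ∂μ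
      ≤ ∫⁻ ω, 2 * ∑ k ∈ Finset.range n, ∑ j ∈ Finset.range (k + 1),
          greenNbr S μ (S j ω - S n ω) * greenNbr S μ (S k ω - S n ω) ∂μ :=
        lintegral_mono fun ω => sq_sum_range_le _ n
    _ = 2 * ∑ k ∈ Finset.range n, ∑ j ∈ Finset.range (k + 1),
          ∫⁻ ω, greenNbr S μ (S j ω - S n ω) * greenNbr S μ (S k ω - S n ω) ∂μ := by
        rw [lintegral_const_mul _ (Finset.measurable_fun_sum _ fun k _ =>
          Finset.measurable_fun_sum _ fun j _ => hm2 j k),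
          lintegral_finsetSum _ fun k _ =>
            Finset.measurable_fun_sum _ fun j _ => hm2 j k]
        congr 1
        refine Finset.sum_congr rfl fun k _ => ?_
        rw [lintegral_finsetSum _ fun j _ => hm2 j k]
    _ ≤ 2 * ∑ k ∈ Finset.range n, ∑ j ∈ Finset.range (k + 1),
          (2 * d * heatTail d (k - j)) * (2 * d * heatTail d (n - k)) := by
        gcongr with k hk j hj
        have h := hS.lintegral_greenNbr_mul_le hd j (k - j) (n - k)
        have hk' := Finset.mem_range.1 hk
        have hj' := Finset.mem_range.1 hj
        rwa [show j + (k - j) = k by omega, show k + (n - k) = n by omega] at h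
    -- The gaps `k - j` and `n - k` never exceed `n`, so after reversing the order of summation each
    -- sum is part of `B`.
    _ ≤ 2 * ∑ k ∈ Finset.range n, (2 * d * B) * (2 * d * heatTail d (n - k)) := by
        gcongr with k hk
        rw [← Finset.sum_mul, ← Finset.mul_sum]
        gcongr
        have hk' := Finset.mem_range.1 hk
        have h := Finset.sum_range_reflect (fun i => heatTail d i) (k + 1)
        simp only [Nat.add_sub_cancel] at h
        rw [h, hB]
        exact Finset.sum_le_sum_of_subset (Finset.range_mono (by omega))
    _ ≤ 2 * ((2 * d * B) * (2 * d * B)) := by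
        rw [← Finset.mul_sum, ← Finset.mul_sum]
        gcongr
        have h := Finset.sum_range_reflect (fun i => heatTail d i) (n + 1)
        simp only [Nat.add_sub_cancel] at h
        rw [hB, ← h]
        exact Finset.sum_le_sum_of_subset (Finset.range_mono (by omega))
    _ = _ := by rw [sq]

theorem exists_lintegral_greenSum_sq_le {d : ℕ} (hd : 3 ≤ d) :
    ∃ K : ℝ, 0 < K ∧ ∀ {Ω : Type*} [MeasurableSpace Ω] {μ : Measure Ω} [IsProbabilityMeasure μ]
      {S : ℕ → Ω → (Fin d → ℤ)}, IsSimpleRandomWalk S μ → ∀ n : ℕ,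
      ∫⁻ ω, greenSum S μ n ω ^ 2 ∂μ ≤ ENNReal.ofReal
        (K * (∑ m ∈ Finset.range (n + 1), ((m : ℝ) + 1) ^ (-((d : ℝ) / 2 - 1))) ^ 2) := by
  have hd0 : (0 : ℝ) < d := by exact_mod_cast (by omega : 0 < d)
  refine ⟨2 * (2 * d * (4 * (2 * (d : ℝ)) ^ ((d : ℝ) / 2))) ^ 2, by positivity, ?_⟩
  intro Ω _ μ _ S hS n
  refine (hS.lintegral_greenSum_sq_le_heatTail (by omega) n).trans ?_
  have h1 : ∑ m ∈ Finset.range (n + 1), heatTail d m ≤ ENNReal.ofReal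
      (∑ m ∈ Finset.range (n + 1),
        4 * (2 * (d : ℝ)) ^ ((d : ℝ) / 2) * ((m : ℝ) + 1) ^ (-((d : ℝ) / 2 - 1))) := by
    rw [ENNReal.ofReal_sum_of_nonneg fun m _ => by positivity]
    exact Finset.sum_le_sum fun m _ => heatTail_le hd m
  rw [← Finset.mul_sum] at h1
  have h2 : (2 * d : ℝ≥0∞) = ENNReal.ofReal (2 * d) := by
    rw [ENNReal.ofReal_mul (by norm_num)]; simp
  have h3 : (2 : ℝ≥0∞) = ENNReal.ofReal 2 := by simp
  calc _ ≤ 2 * (2 * d * ENNReal.ofReal (4 * (2 * (d : ℝ)) ^ ((d : ℝ) / 2) *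
        ∑ m ∈ Finset.range (n + 1), ((m : ℝ) + 1) ^ (-((d : ℝ) / 2 - 1)))) ^ 2 := by gcongr
    _ = _ := by
      rw [h2, ← ENNReal.ofReal_mul (by positivity), ← ENNReal.ofReal_pow (by positivity), h3,
        ← ENNReal.ofReal_mul (by positivity)]
      congr 1
      ring

end SecondMoment

/-! ### Counting sites by their first visit -/

section Paths

variable {d : ℕ}

open Classical in
/-- The set `V ⊆ V₀` with `(s_k + V₀) ∩ R_{k-1}ᶜ = s_k + V`. -/
noncomputable def freshNbrs (s : ℕ → Fin d → ℤ) (k : ℕ) : Finset (Fin d → ℤ) :=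
  {z ∈ V0 d | s k + z ∉ visitedBefore s k}

open Classical in
/-- Indicator that the path discovers a new site at time `k`, which still has a neighbour outside
`R_n`. -/
noncomputable def exposedUpTo (s : ℕ → Fin d → ℤ) (n k : ℕ) : ℝ :=
  if s k ∉ visitedBefore s k ∧ ∃ z ∈ V0 d, s k + z ∉ walkRange s n then 1 else 0

open Classical in
/-- Indicator that the path discovers a new site at time `k`, which has a neighbour that is never
visited. -/
noncomputable def exposedForever (s : ℕ → Fin d → ℤ) (k : ℕ) : ℝ :=
  if s k ∉ visitedBefore s k ∧ ∃ z ∈ V0 d, s k + z ∉ Set.range s then 1 else 0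

open Classical in
/-- The conditional probability that a site discovered at time `k` is exposed forever. -/
noncomputable def exposureProb (ρ : Finset (Fin d → ℤ) → ℝ) (s : ℕ → Fin d → ℤ) (k : ℕ) : ℝ :=
  if s k ∉ visitedBefore s k then ρ (freshNbrs s k) else 0

theorem freshNbrs_mem_powerset (s : ℕ → Fin d → ℤ) (k : ℕ) :
    freshNbrs s k ∈ (V0 d).powerset := by
  classical
  exact Finset.mem_powerset.2 (Finset.filter_subset _ _)

theorem image_inter_compl_eq_iff (s : ℕ → Fin d → ℤ) (k : ℕ) (V : Finset (Fin d → ℤ)) :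
    ((fun z => s k + z) '' (V0 d : Set (Fin d → ℤ))) ∩ (visitedBefore s k)ᶜ =
      (fun z => s k + z) '' (V : Set (Fin d → ℤ)) ↔ freshNbrs s k = V := by
  classical
  have h : ((fun z => s k + z) '' (V0 d : Set (Fin d → ℤ))) ∩ (visitedBefore s k)ᶜ =
      (fun z => s k + z) '' (freshNbrs s k : Set (Fin d → ℤ)) := by
    ext x
    simp only [freshNbrs, Set.mem_inter_iff, Set.mem_image, Finset.mem_coe, Set.mem_compl_iff,
      Finset.mem_filter]
    constructor
    · rintro ⟨⟨z, hz, rfl⟩, h⟩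
      exact ⟨z, ⟨hz, h⟩, rfl⟩
    · rintro ⟨z, ⟨hz, h⟩, rfl⟩
      exact ⟨⟨z, hz, rfl⟩, h⟩
  rw [h, (Set.image_injective.2 (add_right_injective (s k))).eq_iff, Finset.coe_inj]

-- First-visit times are in bijection with visited sites, so a set of sites selected at first visit
-- has the cardinality of its set of times.
open Classical in
theorem ncard_firstVisit (s : ℕ → Fin d → ℤ) (n : ℕ) (Q : ℕ → Prop) :
    ({x | ∃ k ≤ n, s k = x ∧ s k ∉ visitedBefore s k ∧ Q k}.ncard : ℝ) =
      ∑ k ∈ Finset.range (n + 1), if s k ∉ visitedBefore s k ∧ Q k then (1 : ℝ) else 0 := by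
  have h : {x | ∃ k ≤ n, s k = x ∧ s k ∉ visitedBefore s k ∧ Q k} =
      s '' (({k ∈ Finset.range (n + 1) | s k ∉ visitedBefore s k ∧ Q k} : Finset ℕ) : Set ℕ) := by
    ext x
    simp only [Set.mem_ofPred_eq, Set.mem_image, Finset.mem_coe, Finset.mem_filter,
      Finset.mem_range, Nat.lt_succ_iff]
    constructor
    · rintro ⟨k, h1, h2, h3⟩
      exact ⟨k, ⟨h1, h3⟩, h2⟩
    · rintro ⟨k, ⟨h1, h3⟩, h2⟩
      exact ⟨k, h1, h2, h3⟩
  rw [h, Set.InjOn.ncard_image, Set.ncard_coe_finset, Finset.card_filter]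
  · push_cast
    rfl
  · intro a ha b hb hab
    have ha' := (Finset.mem_filter.1 ha).2.1
    have hb' := (Finset.mem_filter.1 hb).2.1
    rcases lt_trichotomy a b with h | h | h
    · exact absurd ⟨a, h, hab⟩ hb'
    · exact h
    · exact absurd ⟨b, h, hab.symm⟩ ha'

theorem ncard_boundary_walkRange (s : ℕ → Fin d → ℤ) (n : ℕ) :
    ((boundary (walkRange s n)).ncard : ℝ) = ∑ k ∈ Finset.range (n + 1), exposedUpTo s n k := by
  classical
  have h : boundary (walkRange s n) = {x | ∃ k ≤ n, s k = x ∧ s k ∉ visitedBefore s k ∧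
      ∃ z ∈ V0 d, s k + z ∉ walkRange s n} := by
    ext x
    constructor
    · rintro ⟨⟨k, hk, rfl⟩, y, hy, hyn⟩
      -- The visit at time `k` need not be the first one; `Nat.find` selects the first.
      have hex : ∃ j, s j = s k := ⟨k, rfl⟩
      have hj : s (Nat.find hex) = s k := Nat.find_spec hex
      refine ⟨Nat.find hex, (Nat.find_min' hex rfl).trans hk, hj, ?_, y - s k, ?_, ?_⟩
      · rintro ⟨i, hi, h⟩
        exact Nat.find_min hex hi (h.trans hj)
      · rw [mem_V0]
        simpa [Nbr] using hy
      · rw [hj]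
        simpa using hyn
    · rintro ⟨k, hk, rfl, -, z, hz, hzn⟩
      refine ⟨⟨k, hk, rfl⟩, s k + z, ?_, hzn⟩
      rw [mem_V0] at hz
      simpa [Nbr] using hz
  rw [h, ncard_firstVisit]
  refine Finset.sum_congr rfl fun k _ => ?_
  rw [exposedUpTo]
  congr

/-- A new site belongs to exactly one class, that of `V = freshNbrs s k`, so the sum over `V`
collapses. -/
theorem sum_mul_ncard_rangeV (ρ : Finset (Fin d → ℤ) → ℝ) (s : ℕ → Fin d → ℤ) (n : ℕ) :
    ∑ V ∈ (V0 d).powerset, ρ V * ((rangeV s n V).ncard : ℝ) =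
      ∑ k ∈ Finset.range (n + 1), exposureProb ρ s k := by
  classical
  have h : ∀ V, ((rangeV s n V).ncard : ℝ) = ∑ k ∈ Finset.range (n + 1),
      if s k ∉ visitedBefore s k ∧ freshNbrs s k = V then (1 : ℝ) else 0 := by
    intro V
    refine Eq.trans ?_ ((ncard_firstVisit s n fun k => freshNbrs s k = V).trans
      (Finset.sum_congr rfl fun k _ => by congr))
    simp only [← image_inter_compl_eq_iff]
    rfl
  simp_rw [h, Finset.mul_sum]
  rw [Finset.sum_comm]
  refine Finset.sum_congr rfl fun k _ => ?_
  rw [Finset.sum_eq_single_of_mem _ (freshNbrs_mem_powerset s k)]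
  · simp [exposureProb]
  · intro V _ hV
    rw [if_neg fun h => hV h.2.symm, mul_zero]

theorem exposedUpTo_mem_Icc (s : ℕ → Fin d → ℤ) (n k : ℕ) :
    exposedUpTo s n k ∈ Set.Icc (0 : ℝ) 1 := by
  rw [exposedUpTo]
  split_ifs <;> simp

theorem exposedForever_mem_Icc (s : ℕ → Fin d → ℤ) (k : ℕ) :
    exposedForever s k ∈ Set.Icc (0 : ℝ) 1 := by
  rw [exposedForever]
  split_ifs <;> simp

theorem exposureProb_mem_Icc {ρ : Finset (Fin d → ℤ) → ℝ} (hρ : ∀ V, ρ V ∈ Set.Icc (0 : ℝ) 1)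
    (s : ℕ → Fin d → ℤ) (k : ℕ) : exposureProb ρ s k ∈ Set.Icc (0 : ℝ) 1 := by
  rw [exposureProb]
  split_ifs
  · simp
  · exact hρ _

theorem walkRange_subset_range (s : ℕ → Fin d → ℤ) (n : ℕ) : walkRange s n ⊆ Set.range s := by
  rintro _ ⟨k, -, rfl⟩
  exact ⟨k, rfl⟩

theorem exposedForever_le_exposedUpTo (s : ℕ → Fin d → ℤ) (n k : ℕ) :
    exposedForever s k ≤ exposedUpTo s n k := by
  by_cases h : s k ∉ visitedBefore s k ∧ ∃ z ∈ V0 d, s k + z ∉ Set.range s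
  · obtain ⟨h1, z, hz, h2⟩ := h
    rw [exposedUpTo, if_pos ⟨h1, z, hz, fun h3 => h2 (walkRange_subset_range s n h3)⟩]
    exact (exposedForever_mem_Icc s k).2
  · rw [exposedForever, if_neg h]
    exact (exposedUpTo_mem_Icc s n k).1

/-- An exposed site that does not stay exposed forever has a neighbour that is visited later. -/
theorem ofReal_exposedUpTo_sub_le (s : ℕ → Fin d → ℤ) (n k : ℕ) :
    ENNReal.ofReal (exposedUpTo s n k - exposedForever s k) ≤
      ∑ z ∈ V0 d, ∑' l : ℕ, if s k + z - s n = s (n + l) - s n then (1 : ℝ≥0∞) else 0 := by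
  classical
  by_cases h1 : s k ∉ visitedBefore s k ∧ ∃ z ∈ V0 d, s k + z ∉ walkRange s n
  swap
  · rw [exposedUpTo, if_neg h1, ENNReal.ofReal_of_nonpos]
    · exact zero_le
    · linarith [(exposedForever_mem_Icc s k).1]
  by_cases h2 : s k ∉ visitedBefore s k ∧ ∃ z ∈ V0 d, s k + z ∉ Set.range s
  · rw [exposedForever, if_pos h2, ENNReal.ofReal_of_nonpos]
    · exact zero_le
    · linarith [(exposedUpTo_mem_Icc s n k).2]
  · obtain ⟨h3, z, hz, h4⟩ := h1
    have h5 : s k + z ∈ Set.range s := by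
      by_contra h5
      exact h2 ⟨h3, z, hz, h5⟩
    obtain ⟨j, hj⟩ := h5
    have hj' : n ≤ j := by
      by_contra hlt
      exact h4 ⟨j, by omega, hj⟩
    calc ENNReal.ofReal (exposedUpTo s n k - exposedForever s k) ≤ 1 := by
          rw [ENNReal.ofReal_le_one]
          linarith [(exposedUpTo_mem_Icc s n k).2, (exposedForever_mem_Icc s k).1]
      _ = if s k + z - s n = s (n + (j - n)) - s n then (1 : ℝ≥0∞) else 0 := by
          rw [Nat.add_sub_cancel' hj', hj, if_pos rfl]
      _ ≤ ∑' l : ℕ, if s k + z - s n = s (n + l) - s n then (1 : ℝ≥0∞) else 0 :=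
          ENNReal.le_tsum (j - n)
      _ ≤ _ := Finset.single_le_sum
          (f := fun z => ∑' l : ℕ, if s k + z - s n = s (n + l) - s n then (1 : ℝ≥0∞) else 0)
          (fun _ _ => zero_le) hz

/-- This and the following congruence lemmas are the deterministic form of adaptedness: only the
path up to the given time matters. -/
theorem visitedBefore_congr {s t : ℕ → Fin d → ℤ} {k : ℕ} (h : ∀ i ≤ k, s i = t i) :
    visitedBefore s k = visitedBefore t k := by
  ext x
  constructor
  · rintro ⟨j, hj, rfl⟩
    exact ⟨j, hj, (h j hj.le).symm⟩
  · rintro ⟨j, hj, rfl⟩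
    exact ⟨j, hj, h j hj.le⟩

theorem walkRange_congr {s t : ℕ → Fin d → ℤ} {n : ℕ} (h : ∀ i ≤ n, s i = t i) :
    walkRange s n = walkRange t n := by
  ext x
  constructor
  · rintro ⟨j, hj, rfl⟩
    exact ⟨j, hj, (h j hj).symm⟩
  · rintro ⟨j, hj, rfl⟩
    exact ⟨j, hj, h j hj⟩

theorem exposedUpTo_congr {s t : ℕ → Fin d → ℤ} {n k : ℕ} (hk : k ≤ n) (h : ∀ i ≤ n, s i = t i) :
    exposedUpTo s n k = exposedUpTo t n k := by
  rw [exposedUpTo, exposedUpTo, visitedBefore_congr fun i hi => h i (hi.trans hk), walkRange_congr h,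
    h k hk]

theorem freshNbrs_congr {s t : ℕ → Fin d → ℤ} {k : ℕ} (h : ∀ i ≤ k, s i = t i) :
    freshNbrs s k = freshNbrs t k := by
  rw [freshNbrs, freshNbrs, visitedBefore_congr h, h k le_rfl]

theorem exposureProb_congr (ρ : Finset (Fin d → ℤ) → ℝ) {s t : ℕ → Fin d → ℤ} {k : ℕ}
    (h : ∀ i ≤ k, s i = t i) : exposureProb ρ s k = exposureProb ρ t k := by
  rw [exposureProb, exposureProb, visitedBefore_congr h, freshNbrs_congr h, h k le_rfl]

/-- Neighbours visited before time `k` are never candidates, so permanent exposure becomes an event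
about the recentred future path, once the fresh set is known. -/
theorem not_freshNbrs_subset_iff (s : ℕ → Fin d → ℤ) (k : ℕ) :
    (¬ ((freshNbrs s k : Set (Fin d → ℤ)) ⊆ Set.range fun l => s (k + l) - s k)) ↔
      ∃ z ∈ V0 d, s k + z ∉ Set.range s := by
  classical
  rw [Set.not_subset]
  simp only [freshNbrs, Finset.mem_coe, Finset.mem_filter]
  constructor
  · rintro ⟨z, ⟨hz, h1⟩, h2⟩
    refine ⟨z, hz, ?_⟩
    rintro ⟨l, hl⟩
    rcases lt_or_ge l k with h | h
    · exact h1 ⟨l, h, hl⟩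
    · refine h2 ⟨l - k, ?_⟩
      simp only
      rw [Nat.add_sub_cancel' h, hl, add_sub_cancel_left]
  · rintro ⟨z, hz, h⟩
    refine ⟨z, ⟨hz, ?_⟩, ?_⟩
    · rintro ⟨j, -, hj⟩
      exact h ⟨j, hj⟩
    · rintro ⟨l, hl⟩
      exact h ⟨k + l, by rw [← hl, add_sub_cancel]⟩

end Paths

/-! ### Measurability of path functionals -/

section Measurability

variable {d : ℕ} {Ω : Type*} [MeasurableSpace Ω] {μ : Measure Ω} {S : ℕ → Ω → (Fin d → ℤ)}

theorem measurable_walkFiltration_of_congr {β : Type*} [MeasurableSpace β]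
    (hS : ∀ n, Measurable (S n)) (n : ℕ) {F : (ℕ → Fin d → ℤ) → β}
    (hF : ∀ s t : ℕ → Fin d → ℤ, (∀ i ≤ n, s i = t i) → F s = F t) :
    Measurable[walkFiltration S hS n] fun ω => F fun k => S k ω := by
  refine measurable_walkFiltration_of_history hS n
    (fun h => F fun i => h ⟨min i n, by omega⟩) fun ω => hF _ _ fun i hi => ?_
  simp [history, min_eq_left hi]

theorem measurable_exposedForever (hS : ∀ n, Measurable (S n)) (k : ℕ) :
    Measurable fun ω => exposedForever (fun i => S i ω) k := by
  classical
  simp only [exposedForever]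
  refine Measurable.ite ?_ measurable_const measurable_const
  have h : {ω | S k ω ∉ visitedBefore (fun i => S i ω) k ∧
      ∃ z ∈ V0 d, S k ω + z ∉ Set.range fun i => S i ω} =
      {ω | S k ω ∉ visitedBefore (fun i => S i ω) k} ∩
        ⋃ z ∈ V0 d, ⋂ l, (fun ω => S l ω - S k ω) ⁻¹' {z}ᶜ := by
    ext ω
    simp only [Set.mem_ofPred_eq, Set.mem_inter_iff, Set.mem_iUnion, Set.mem_iInter,
      Set.mem_preimage, Set.mem_compl_iff, Set.mem_singleton_iff, Set.mem_range, not_exists,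
      exists_prop, sub_eq_iff_eq_add, add_comm]
  rw [h]
  refine MeasurableSet.inter ?_ ?_
  · have hm : Measurable[walkFiltration S hS k]
        fun ω => (fun s : ℕ → Fin d → ℤ => s k ∉ visitedBefore s k) fun i => S i ω := by
      refine measurable_walkFiltration_of_congr hS k
        (F := fun s : ℕ → Fin d → ℤ => s k ∉ visitedBefore s k) fun s t hst => ?_
      simp only [visitedBefore_congr hst, hst k le_rfl]
    exact measurableSet_setOfPred.2 (hm.mono ((walkFiltration S hS).le k) le_rfl)
  · refine Finset.measurableSet_biUnion _ fun z _ => MeasurableSet.iInter fun l => ?_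
    exact ((hS l).sub (hS k)) (measurableSet_singleton z).compl

end Measurability

/-! ### Adaptedness and square-integrability of the indicators -/

section Decomposition

variable {d : ℕ} {Ω : Type*} [MeasurableSpace Ω] {μ : Measure Ω} {S : ℕ → Ω → (Fin d → ℤ)}

theorem rho_mem_Icc [IsProbabilityMeasure μ] (V : Finset (Fin d → ℤ)) :
    rho S μ V ∈ Set.Icc (0 : ℝ) 1 :=
  ⟨measureReal_nonneg, measureReal_le_one⟩

theorem measurable_exposedUpTo (hS : ∀ n, Measurable (S n)) {n k : ℕ} (hk : k ≤ n) :
    Measurable[walkFiltration S hS n] fun ω => exposedUpTo (fun i => S i ω) n k :=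
  measurable_walkFiltration_of_congr hS n (F := fun s => exposedUpTo s n k)
    fun _ _ h => exposedUpTo_congr hk h

theorem measurable_exposureProb (hS : ∀ n, Measurable (S n)) (ρ : Finset (Fin d → ℤ) → ℝ)
    {n k : ℕ} (hk : k ≤ n) :
    Measurable[walkFiltration S hS n] fun ω => exposureProb ρ (fun i => S i ω) k :=
  measurable_walkFiltration_of_congr hS n (F := fun s => exposureProb ρ s k)
    fun _ _ h => exposureProb_congr ρ fun i hi => h i (hi.trans hk)

theorem memLp_of_mem_Icc [IsProbabilityMeasure μ] {f : Ω → ℝ} (hf : Measurable f)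
    (h : ∀ ω, f ω ∈ Set.Icc (0 : ℝ) 1) : MemLp f 2 μ :=
  MemLp.of_bound hf.aestronglyMeasurable 1 <| ae_of_all _ fun ω => by
    rw [Real.norm_eq_abs, abs_le]
    constructor <;> linarith [(h ω).1, (h ω).2]

theorem memLp_exposedUpTo [IsProbabilityMeasure μ] (hS : ∀ n, Measurable (S n)) {n k : ℕ}
    (hk : k ≤ n) : MemLp (fun ω => exposedUpTo (fun i => S i ω) n k) 2 μ :=
  memLp_of_mem_Icc ((measurable_exposedUpTo hS hk).mono ((walkFiltration S hS).le n) le_rfl)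
    fun _ => exposedUpTo_mem_Icc _ _ _

theorem memLp_exposedForever [IsProbabilityMeasure μ] (hS : ∀ n, Measurable (S n)) (k : ℕ) :
    MemLp (fun ω => exposedForever (fun i => S i ω) k) 2 μ :=
  memLp_of_mem_Icc (measurable_exposedForever hS k) fun _ => exposedForever_mem_Icc _ _

theorem memLp_exposureProb [IsProbabilityMeasure μ] (hS : ∀ n, Measurable (S n)) (k : ℕ) :
    MemLp (fun ω => exposureProb (rho S μ) (fun i => S i ω) k) 2 μ :=
  memLp_of_mem_Icc ((measurable_exposureProb hS _ le_rfl).mono ((walkFiltration S hS).le k) le_rfl)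
    fun _ => exposureProb_mem_Icc rho_mem_Icc _ _

/-! ### The martingale part -/

-- Splitting by the value `V` of the fresh set turns each term into a past event intersected with a
-- future event, the form to which the Markov property applies.
omit [MeasurableSpace Ω] in
open Classical in
theorem exposedForever_sub_exposureProb_eq (ρ : Finset (Fin d → ℤ) → ℝ) (k : ℕ) (ω : Ω) :
    exposedForever (fun i => S i ω) k - exposureProb ρ (fun i => S i ω) k =
      ∑ V ∈ (V0 d).powerset,
        (({ω | S k ω ∉ visitedBefore (fun i => S i ω) k ∧ freshNbrs (fun i => S i ω) k = V} ∩
          shiftedWalk S k ⁻¹' {w | ¬ ((V : Set (Fin d → ℤ)) ⊆ Set.range w)}).indicator 1 ω -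
        ρ V * {ω | S k ω ∉ visitedBefore (fun i => S i ω) k ∧
          freshNbrs (fun i => S i ω) k = V}.indicator 1 ω) := by
  rw [Finset.sum_eq_single_of_mem _ (freshNbrs_mem_powerset (fun i => S i ω) k)]
  · have h := not_freshNbrs_subset_iff (fun i => S i ω) k
    have h' : shiftedWalk S k ω = fun l => S (k + l) ω - S k ω := rfl
    by_cases h1 : S k ω ∉ visitedBefore (fun i => S i ω) k
    · simp only [exposedForever, exposureProb, Set.indicator, Set.mem_inter_iff, Set.mem_ofPred_eq,
        Set.mem_preimage, h1, not_false_eq_true, true_and, and_self, if_true, Pi.one_apply, mul_one,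
        h', ← h]
    · simp [exposedForever, exposureProb, Set.indicator, h1]
  · intro V _ hV
    simp [Set.indicator, Ne.symm hV]

/-- On each past event with fresh set `V`, the recentred future misses part of `V` with probability
`ρ_V`, independently of the past. -/
theorem IsSimpleRandomWalk.condExp_exposedForever_sub [IsProbabilityMeasure μ]
    (hS : IsSimpleRandomWalk S μ) (hd : 0 < d) (k : ℕ) :
    μ[fun ω => exposedForever (fun i => S i ω) k - exposureProb (rho S μ) (fun i => S i ω) k |
      walkFiltration S hS.measurable k] =ᵐ[μ] 0 := by
  classical
  have hint : Integrable (fun ω => exposedForever (fun i => S i ω) k -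
      exposureProb (rho S μ) (fun i => S i ω) k) μ :=
    ((memLp_exposedForever hS.measurable k).integrable one_le_two).sub
      ((memLp_exposureProb hS.measurable k).integrable one_le_two)
  refine (ae_eq_condExp_of_forall_setIntegral_eq ((walkFiltration S hS.measurable).le k) hint
    (fun s _ _ => integrableOn_zero) (fun s hs _ => ?_)
    aestronglyMeasurable_zero).symm
  set N : Finset (Fin d → ℤ) → Set Ω := fun V =>
    {ω | S k ω ∉ visitedBefore (fun i => S i ω) k ∧ freshNbrs (fun i => S i ω) k = V} with hN
  set A : Finset (Fin d → ℤ) → Set (ℕ → Fin d → ℤ) := fun V =>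
    {w | ¬ ((V : Set (Fin d → ℤ)) ⊆ Set.range w)} with hA
  have hNm : ∀ V, MeasurableSet[walkFiltration S hS.measurable k] (N V) := by
    intro V
    have := measurable_walkFiltration_of_congr hS.measurable k
      (F := fun s : ℕ → Fin d → ℤ => s k ∉ visitedBefore s k ∧ freshNbrs s k = V)
      fun s t hst => by
        simp only [visitedBefore_congr hst, freshNbrs_congr hst, hst k le_rfl]
    exact (@measurableSet_setOfPred _ (walkFiltration S hS.measurable k) _).2 this
  have hAm : ∀ V, MeasurableSet (A V) := by
    intro V
    have : A V = ⋃ z ∈ V, ⋂ l, (fun w : ℕ → Fin d → ℤ => w l) ⁻¹' {z}ᶜ := by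
      ext w
      simp [hA, Set.not_subset]
    rw [this]
    refine Finset.measurableSet_biUnion _ fun z _ => MeasurableSet.iInter fun l => ?_
    exact measurable_pi_apply l (measurableSet_singleton z).compl
  have hle := (walkFiltration S hS.measurable).le k
  have hNAm : ∀ V, MeasurableSet (N V ∩ shiftedWalk S k ⁻¹' A V) := fun V =>
    (hle _ (hNm V)).inter (hS.measurable_shiftedWalk k (hAm V))
  simp only [integral_zero]
  simp_rw [exposedForever_sub_exposureProb_eq]
  rw [integral_finsetSum]
  · refine (Finset.sum_eq_zero fun V _ => ?_).symm
    rw [integral_sub, integral_const_mul]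
    · rw [integral_indicator_one (hNAm V), integral_indicator_one (hle _ (hNm V)),
        measureReal_restrict_apply (hNAm V), measureReal_restrict_apply (hle _ (hNm V))]
      have h := hS.measure_inter_shiftedWalk hd k ((hNm V).inter hs) (hAm V)
      have h2 : N V ∩ shiftedWalk S k ⁻¹' A V ∩ s = N V ∩ s ∩ shiftedWalk S k ⁻¹' A V := by
        rw [Set.inter_right_comm]
      rw [h2, Measure.real, h, ENNReal.toReal_mul, mul_comm, sub_eq_zero]
      rfl
    · exact (integrable_const (1 : ℝ)).indicator (hNAm V)
    · exact ((integrable_const (1 : ℝ)).indicator (hle _ (hNm V))).const_mul _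
  · intro V _
    exact Integrable.sub ((integrable_const (1 : ℝ)).indicator (hNAm V))
      (((integrable_const (1 : ℝ)).indicator (hle _ (hNm V))).const_mul _)

/-- The number of sites discovered before time `n` that are exposed forever, compensated by the
conditional probabilities of exposure. -/
noncomputable def compensatedExposure (S : ℕ → Ω → (Fin d → ℤ)) (μ : Measure Ω) (n : ℕ) (ω : Ω) :
    ℝ :=
  ∑ k ∈ Finset.range n,
    (exposedForever (fun i => S i ω) k - exposureProb (rho S μ) (fun i => S i ω) k)

theorem memLp_compensatedExposure [IsProbabilityMeasure μ] (hS : ∀ n, Measurable (S n)) (n : ℕ) :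
    MemLp (compensatedExposure S μ n) 2 μ :=
  memLp_finsetSum _ fun k _ => (memLp_exposedForever hS k).sub (memLp_exposureProb hS k)

/-- By the tower property the conditional expectation of the next value given `F_n` is that of the
sum up to `n + 1`, and its last summand has conditional mean zero. -/
theorem IsSimpleRandomWalk.martingale_compensatedExposure [IsProbabilityMeasure μ]
    (hS : IsSimpleRandomWalk S μ) (hd : 0 < d) :
    Martingale (fun n => μ[compensatedExposure S μ n | walkFiltration S hS.measurable n])
      (walkFiltration S hS.measurable) μ := by
  have hint : ∀ n, Integrable (compensatedExposure S μ n) μ := fun n =>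
    (memLp_compensatedExposure hS.measurable n).integrable one_le_two
  refine martingale_nat (fun n => stronglyMeasurable_condExp) (fun n => integrable_condExp)
    fun n => ?_
  have h1 := condExp_condExp_of_le (μ := μ) (f := compensatedExposure S μ (n + 1))
    ((walkFiltration S hS.measurable).mono n.le_succ) ((walkFiltration S hS.measurable).le (n + 1))
  have h2 : compensatedExposure S μ (n + 1) = compensatedExposure S μ n + fun ω =>
      exposedForever (fun i => S i ω) n - exposureProb (rho S μ) (fun i => S i ω) n := by
    funext ω
    exact Finset.sum_range_succ _ n
  have h3 := condExp_add (hint n)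
    (((memLp_exposedForever hS.measurable n).integrable (μ := μ) one_le_two).sub
      ((memLp_exposureProb hS.measurable n).integrable one_le_two))
    (walkFiltration S hS.measurable n)
  rw [h2] at h1
  filter_upwards [h1, h3, hS.condExp_exposedForever_sub hd n] with ω e1 e2 e3
  rw [h2, e1]
  refine Eq.trans ?_ e2.symm
  have e3' : (μ[(fun ω => exposedForever (fun i => S i ω) n) -
      fun ω => exposureProb (rho S μ) (fun i => S i ω) n | walkFiltration S hS.measurable n]) ω = 0 :=
    e3
  rw [Pi.add_apply, e3', add_zero]

/-! ### The error term -/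

/-- The number of sites on the boundary of `R_n`, discovered before time `n`, that are covered
later. -/
noncomputable def laterCovered (S : ℕ → Ω → (Fin d → ℤ)) (n : ℕ) (ω : Ω) : ℝ :=
  ∑ k ∈ Finset.range n,
    (exposedUpTo (fun i => S i ω) n k - exposedForever (fun i => S i ω) k)

theorem memLp_laterCovered [IsProbabilityMeasure μ] (hS : ∀ n, Measurable (S n)) (n : ℕ) :
    MemLp (laterCovered S n) 2 μ :=
  memLp_finsetSum _ fun k hk =>
    (memLp_exposedUpTo hS (Finset.mem_range.1 hk).le).sub (memLp_exposedForever hS k)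

omit [MeasurableSpace Ω] in
theorem laterCovered_nonneg (n : ℕ) (ω : Ω) : 0 ≤ laterCovered S n ω :=
  Finset.sum_nonneg fun _ _ => sub_nonneg.2 (exposedForever_le_exposedUpTo _ _ _)

/-- The target `S k + z - S n` is known at time `n`, so the expected number of later visits to it is
its Green function. The statement over sets of `F_n` is the one needed for conditional expectations.
-/
theorem IsSimpleRandomWalk.setLIntegral_tsum_hit [IsProbabilityMeasure μ]
    (hS : IsSimpleRandomWalk S μ) (hd : 0 < d) {n k : ℕ} (hk : k ≤ n) (z : Fin d → ℤ) {s : Set Ω}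
    (hs : MeasurableSet[walkFiltration S hS.measurable n] s) :
    ∫⁻ ω in s, ∑' l : ℕ, (if S k ω + z - S n ω = S (n + l) ω - S n ω then (1 : ℝ≥0∞) else 0) ∂μ =
      ∫⁻ ω in s, green S μ (S k ω + z - S n ω) ∂μ := by
  classical
  have hle := (walkFiltration S hS.measurable).le n
  have hX : Measurable fun ω => S k ω + z - S n ω :=
    ((hS.measurable k).add_const z).sub (hS.measurable n)
  have hXF : Measurable[walkFiltration S hS.measurable n] fun ω => S k ω + z - S n ω :=
    measurable_walkFiltration_of_congr hS.measurable n
      (F := fun s : ℕ → Fin d → ℤ => s k + z - s n) fun s t h => by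
        simp only [h k hk, h n le_rfl]
  simp only [green]
  rw [lintegral_tsum, lintegral_tsum]
  · refine tsum_congr fun l => ?_
    set f : Ω → (Fin d → ℤ) → ℝ≥0∞ := fun ω x =>
      (s ∩ (fun ω => S k ω + z - S n ω) ⁻¹' {x}).indicator 1 ω with hf
    have hsx : ∀ x, MeasurableSet[walkFiltration S hS.measurable n]
        (s ∩ (fun ω => S k ω + z - S n ω) ⁻¹' {x}) := fun x =>
      hs.inter (hXF (measurableSet_singleton x))
    have h := hS.lintegral_comp_sub hd n l f fun x =>
      ((stronglyMeasurable_const (b := (1 : ℝ≥0∞))).indicator (hsx x)).measurable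
    calc _ = ∫⁻ ω, f ω (S (n + l) ω - S n ω) ∂μ := by
          rw [← lintegral_indicator (hle _ hs)]
          refine lintegral_congr fun ω => ?_
          by_cases h1 : ω ∈ s <;> simp [hf, Set.indicator, h1]
      _ = ∑' x, μ {ω | S l ω = x} * ∫⁻ ω, f ω x ∂μ := h
      _ = ∑' x, ∫⁻ ω, μ {ω | S l ω = x} * f ω x ∂μ := by
          refine tsum_congr fun x => ?_
          rw [lintegral_const_mul _ (measurable_one.indicator (hle _ (hsx x)))]
      _ = ∫⁻ ω, ∑' x, μ {ω | S l ω = x} * f ω x ∂μ := by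
          rw [lintegral_tsum]
          exact fun x => ((measurable_one.indicator (hle _ (hsx x))).const_mul _).aemeasurable
      _ = _ := by
          rw [← lintegral_indicator (hle _ hs)]
          refine lintegral_congr fun ω => ?_
          rw [tsum_eq_single (S k ω + z - S n ω)]
          · by_cases h1 : ω ∈ s <;> simp [hf, Set.indicator, h1]
          · intro x hx
            simp [hf, Set.indicator, Ne.symm hx]
  · exact fun l => ((measurable_of_countable fun x => μ {ω | S l ω = x}).comp hX).aemeasurable
  · intro l
    refine (Measurable.ite ?_ measurable_const measurable_const).aemeasurable
    exact measurableSet_eq_fun hX ((hS.measurable _).sub (hS.measurable _))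

theorem IsSimpleRandomWalk.setLIntegral_laterCovered_le [IsProbabilityMeasure μ]
    (hS : IsSimpleRandomWalk S μ) (hd : 0 < d) (n : ℕ) {s : Set Ω}
    (hs : MeasurableSet[walkFiltration S hS.measurable n] s) :
    ∫⁻ ω in s, ENNReal.ofReal (laterCovered S n ω) ∂μ ≤ ∫⁻ ω in s, greenSum S μ n ω ∂μ := by
  have hX : ∀ k z, Measurable fun ω => S k ω + z - S n ω := fun k z =>
    ((hS.measurable k).add_const z).sub (hS.measurable n)
  have hm : ∀ k z, Measurable fun ω => ∑' l : ℕ,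
      (if S k ω + z - S n ω = S (n + l) ω - S n ω then (1 : ℝ≥0∞) else 0) := fun k z =>
    Measurable.tsum fun l => Measurable.ite
      (measurableSet_eq_fun (hX k z) ((hS.measurable _).sub (hS.measurable _)))
      measurable_const measurable_const
  have hm' : ∀ k z, Measurable fun ω => green S μ (S k ω + z - S n ω) := fun k z =>
    (measurable_of_countable (green S μ)).comp (hX k z)
  calc ∫⁻ ω in s, ENNReal.ofReal (laterCovered S n ω) ∂μ
      ≤ ∫⁻ ω in s, ∑ k ∈ Finset.range n, ∑ z ∈ V0 d, ∑' l : ℕ,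
          (if S k ω + z - S n ω = S (n + l) ω - S n ω then (1 : ℝ≥0∞) else 0) ∂μ := by
        refine lintegral_mono fun ω => ?_
        simp only [laterCovered]
        rw [ENNReal.ofReal_sum_of_nonneg fun k _ =>
          sub_nonneg.2 (exposedForever_le_exposedUpTo _ _ _)]
        exact Finset.sum_le_sum fun k _ => ofReal_exposedUpTo_sub_le (fun i => S i ω) n k
    _ = ∑ k ∈ Finset.range n, ∑ z ∈ V0 d, ∫⁻ ω in s, green S μ (S k ω + z - S n ω) ∂μ := by
        rw [lintegral_finsetSum _ fun k _ => Finset.measurable_fun_sum _ fun z _ => hm k z]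
        refine Finset.sum_congr rfl fun k hk => ?_
        rw [lintegral_finsetSum _ fun z _ => hm k z]
        exact Finset.sum_congr rfl fun z _ =>
          hS.setLIntegral_tsum_hit hd (Finset.mem_range.1 hk).le z hs
    _ = _ := by
        simp only [greenSum, greenNbr, sub_add_eq_add_sub]
        rw [lintegral_finsetSum _ fun k _ => Finset.measurable_fun_sum _ fun z _ => hm' k z]
        refine Finset.sum_congr rfl fun k hk => ?_
        rw [lintegral_finsetSum _ fun z _ => hm' k z]

theorem IsSimpleRandomWalk.condExp_laterCovered_le [IsProbabilityMeasure μ]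
    (hS : IsSimpleRandomWalk S μ) (hd : 0 < d) (n : ℕ) :
    ∀ᵐ ω ∂μ, ENNReal.ofReal ((μ[laterCovered S n | walkFiltration S hS.measurable n]) ω) ≤
      greenSum S μ n ω := by
  have hle := (walkFiltration S hS.measurable).le n
  have hint : Integrable (laterCovered S n) μ :=
    (memLp_laterCovered hS.measurable n).integrable one_le_two
  have hW : Measurable[walkFiltration S hS.measurable n] fun ω =>
      ENNReal.ofReal ((μ[laterCovered S n | walkFiltration S hS.measurable n]) ω) :=
    ENNReal.measurable_ofReal.comp stronglyMeasurable_condExp.measurable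
  have hT : Measurable[walkFiltration S hS.measurable n] (greenSum S μ n) :=
    measurable_walkFiltration_of_congr hS.measurable n
      (F := fun s : ℕ → Fin d → ℤ => ∑ k ∈ Finset.range n, greenNbr S μ (s k - s n))
      fun s t h => Finset.sum_congr rfl fun k hk => by
        rw [h k (Finset.mem_range.1 hk).le, h n le_rfl]
  refine ae_of_ae_trim hle (ae_le_of_forall_setLIntegral_le_of_sigmaFinite hW fun s hs _ => ?_)
  rw [setLIntegral_trim hle hW hs, setLIntegral_trim hle hT hs]
  refine le_trans (le_of_eq ?_) (hS.setLIntegral_laterCovered_le hd n hs)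
  rw [← ofReal_integral_eq_lintegral_ofReal integrable_condExp.integrableOn,
    ← ofReal_integral_eq_lintegral_ofReal hint.integrableOn, setIntegral_condExp hle hint hs]
  · exact ae_of_all _ fun ω => laterCovered_nonneg n ω
  · exact ae_restrict_of_ae (condExp_nonneg (ae_of_all _ fun ω => laterCovered_nonneg n ω))

/-- The error term in the decomposition of the size of the boundary. -/
noncomputable def boundaryError (hS : IsSimpleRandomWalk S μ) (n : ℕ) (ω : Ω) : ℝ :=
  ((boundary (walkRange (fun k => S k ω) n)).ncard : ℝ) -
    (∑ V ∈ (V0 d).powerset, rho S μ V * ((rangeV (fun k => S k ω) (n - 1) V).ncard : ℝ)) -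
    (μ[compensatedExposure S μ n | walkFiltration S hS.measurable n]) ω

/-- The error is defined as a remainder so that the decomposition holds at every `ω`; the content is
this almost sure formula. The sum `H` is known at time `n`, so it passes through the conditional
expectation. -/
theorem IsSimpleRandomWalk.boundaryError_ae_eq [IsProbabilityMeasure μ]
    (hS : IsSimpleRandomWalk S μ) {n : ℕ} (hn : 1 ≤ n) :
    boundaryError hS n =ᵐ[μ] (fun ω => exposedUpTo (fun i => S i ω) n n) +
      μ[laterCovered S n | walkFiltration S hS.measurable n] := by
  set H : Ω → ℝ := fun ω => ∑ k ∈ Finset.range n,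
    (exposedUpTo (fun i => S i ω) n k - exposureProb (rho S μ) (fun i => S i ω) k) with hH
  have hHm : StronglyMeasurable[walkFiltration S hS.measurable n] H :=
    Measurable.stronglyMeasurable <|
      @Finset.measurable_fun_sum _ _ _ _ _ _ (walkFiltration S hS.measurable n) _ _ fun k hk =>
        (measurable_exposedUpTo hS.measurable (Finset.mem_range.1 hk).le).sub
          (measurable_exposureProb hS.measurable _ (Finset.mem_range.1 hk).le)
  have hHint : Integrable H μ := integrable_finsetSum _ fun k hk =>
    ((memLp_exposedUpTo hS.measurable (Finset.mem_range.1 hk).le).integrable one_le_two).sub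
      ((memLp_exposureProb hS.measurable k).integrable one_le_two)
  have hD : laterCovered S n = H - compensatedExposure S μ n := by
    funext ω
    simp only [laterCovered, hH, compensatedExposure, Pi.sub_apply]
    rw [← Finset.sum_sub_distrib]
    exact Finset.sum_congr rfl fun k _ => by ring
  have h := condExp_sub hHint ((memLp_compensatedExposure (μ := μ) hS.measurable n).integrable
    one_le_two) (walkFiltration S hS.measurable n)
  rw [condExp_of_stronglyMeasurable ((walkFiltration S hS.measurable).le n) hHm hHint] at h
  rw [hD]
  filter_upwards [h] with ω hω
  -- The main term stops at `n - 1`, so it covers the times `k < n`; `1 ≤ n` excludes truncated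
  -- subtraction. The boundary count has the extra time `k = n`.
  rw [Pi.add_apply, hω, boundaryError, ncard_boundary_walkRange, sum_mul_ncard_rangeV,
    Nat.sub_add_cancel hn, Finset.sum_range_succ, Pi.sub_apply, hH]
  simp only [Finset.sum_sub_distrib]
  ring

theorem IsSimpleRandomWalk.memLp_boundaryError [IsProbabilityMeasure μ]
    (hS : IsSimpleRandomWalk S μ) {n : ℕ} (hn : 1 ≤ n) : MemLp (boundaryError hS n) 2 μ :=
  ((memLp_exposedUpTo hS.measurable le_rfl).add
    ((memLp_laterCovered hS.measurable n).condExp one_le_two)).ae_eq (hS.boundaryError_ae_eq hn).symm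

theorem IsSimpleRandomWalk.integral_boundaryError_sq_le [IsProbabilityMeasure μ]
    (hS : IsSimpleRandomWalk S μ) (hd : 0 < d) {n : ℕ} (hn : 1 ≤ n) {a : ℝ} (ha : 0 ≤ a)
    (h : ∫⁻ ω, greenSum S μ n ω ^ 2 ∂μ ≤ ENNReal.ofReal a) :
    ∫ ω, boundaryError hS n ω ^ 2 ∂μ ≤ 2 + 2 * a := by
  set W := μ[laterCovered S n | walkFiltration S hS.measurable n] with hW
  have hWL : MemLp W 2 μ := (memLp_laterCovered hS.measurable n).condExp one_le_two
  have hW0 : 0 ≤ᵐ[μ] W := condExp_nonneg (ae_of_all _ fun ω => laterCovered_nonneg n ω)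
  have h1 : ∫ ω, W ω ^ 2 ∂μ ≤ a := by
    rw [integral_eq_lintegral_of_nonneg_ae (ae_of_all _ fun ω => sq_nonneg _)
      hWL.integrable_sq.aestronglyMeasurable]
    refine ENNReal.toReal_le_of_le_ofReal ha (le_trans (lintegral_mono_ae ?_) h)
    filter_upwards [hW0, hS.condExp_laterCovered_le hd n] with ω h0 h1
    rw [ENNReal.ofReal_pow h0]
    gcongr
  calc ∫ ω, boundaryError hS n ω ^ 2 ∂μ ≤ ∫ ω, (2 + 2 * W ω ^ 2) ∂μ := by
        refine integral_mono_ae (hS.memLp_boundaryError hn).integrable_sq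
          ((integrable_const _).add (hWL.integrable_sq.const_mul _)) ?_
        filter_upwards [hS.boundaryError_ae_eq hn] with ω hω
        rw [hω, Pi.add_apply]
        obtain ⟨e0, e1⟩ := exposedUpTo_mem_Icc (fun i => S i ω) n n
        nlinarith [sq_nonneg (exposedUpTo (fun i => S i ω) n n - W ω)]
    _ = 2 + 2 * ∫ ω, W ω ^ 2 ∂μ := by
        rw [integral_add (integrable_const _) (hWL.integrable_sq.const_mul _), integral_const_mul]
        simp
    _ ≤ _ := by linarith

end Decomposition

end BoundaryRange

/-! ### The three dimension regimes -/

theorem proposition1p1 (d : ℕ) (hd : 3 ≤ d) :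
    ∃ C : ℝ, 0 < C ∧
      ∀ (Ω : Type*) [MeasurableSpace Ω] (μ : Measure Ω) [IsProbabilityMeasure μ]
        (S : ℕ → Ω → (Fin d → ℤ)) (hS : BoundaryRange.IsSimpleRandomWalk S μ),
        ∃ M E : ℕ → Ω → ℝ,
          Martingale M (BoundaryRange.walkFiltration S hS.measurable) μ ∧
          (∀ n : ℕ, 1 ≤ n → ∀ ω : Ω,
            ((BoundaryRange.boundary (BoundaryRange.walkRange (fun k => S k ω) n)).ncard : ℝ) =
              (∑ V ∈ (BoundaryRange.V0 d).powerset, BoundaryRange.rho S μ V *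
                ((BoundaryRange.rangeV (fun k => S k ω) (n - 1) V).ncard : ℝ))
              + M n ω + E n ω) ∧
          (∀ n : ℕ, 1 ≤ n → MemLp (E n) 2 μ) ∧
          (d = 3 → ∀ n : ℕ, 1 ≤ n → ∫ ω, E n ω ^ 2 ∂μ ≤ C * n) ∧
          (d = 4 → ∀ n : ℕ, 2 ≤ n → ∫ ω, E n ω ^ 2 ∂μ ≤ C * Real.log n ^ 3) ∧
          (5 ≤ d → ∀ n : ℕ, 1 ≤ n → ∫ ω, E n ω ^ 2 ∂μ ≤ C) := by
  obtain ⟨K, hK, hgreen⟩ := BoundaryRange.exists_lintegral_greenSum_sq_le hd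
  -- The constant is dictated by `d = 4`: there `2 ≤ 16 log³ n`, and `2K(1 + log(n+1))² ≤ 64K log³
  -- n`.
  refine ⟨16 + 64 * K, by positivity, fun Ω _ μ _ S hS => ?_⟩
  have hbound : ∀ n : ℕ, 1 ≤ n → ∀ b : ℝ,
      ∑ m ∈ Finset.range (n + 1), ((m : ℝ) + 1) ^ (-((d : ℝ) / 2 - 1)) ≤ b →
      ∫ ω, BoundaryRange.boundaryError hS n ω ^ 2 ∂μ ≤ 2 + 2 * (K * b ^ 2) := by
    intro n hn b hb
    refine hS.integral_boundaryError_sq_le (by omega) hn (by positivity)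
      ((hgreen hS n).trans (ENNReal.ofReal_le_ofReal ?_))
    have : 0 ≤ ∑ m ∈ Finset.range (n + 1), ((m : ℝ) + 1) ^ (-((d : ℝ) / 2 - 1)) :=
      Finset.sum_nonneg fun m _ => by positivity
    gcongr
  refine ⟨fun n => μ[BoundaryRange.compensatedExposure S μ n |
      BoundaryRange.walkFiltration S hS.measurable n], BoundaryRange.boundaryError hS,
    hS.martingale_compensatedExposure (by omega), fun n _ ω => ?_,
    fun n hn => hS.memLp_boundaryError hn, ?_, ?_, ?_⟩
  · rw [BoundaryRange.boundaryError]
    ring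
  · rintro rfl n hn
    have hn' : (1 : ℝ) ≤ n := by exact_mod_cast hn
    have h := hbound n hn (2 * √((n + 1 : ℕ) : ℝ)) (by
      have := BoundaryRange.sum_rpow_neg_half_le (n + 1)
      convert this using 4
      norm_num)
    rw [mul_pow, Real.sq_sqrt (by positivity)] at h
    push_cast at h
    nlinarith
  · rintro rfl n hn
    have hn' : (2 : ℝ) ≤ n := by exact_mod_cast hn
    have h := hbound n (by omega) (1 + Real.log ((n + 1 : ℕ) : ℝ)) (by
      have := BoundaryRange.sum_rpow_neg_one_le (n + 1)
      convert this using 4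
      norm_num)
    -- This is where `n ≥ 2` matters: constants and `log² n` are absorbed into `log³ n`.
    have hlog : 1 / 2 ≤ Real.log n :=
      le_trans (by linarith [Real.log_two_gt_d9]) (Real.log_le_log (by norm_num) hn')
    have hlog2 : Real.log ((n + 1 : ℕ) : ℝ) ≤ 2 * Real.log n := by
      have : Real.log ((n : ℝ) ^ 2) = 2 * Real.log n := by
        rw [Real.log_pow]
        norm_num
      rw [← this]
      refine Real.log_le_log (by positivity) ?_
      push_cast
      nlinarith
    have hlog0 : 0 ≤ Real.log ((n + 1 : ℕ) : ℝ) := Real.log_natCast_nonneg _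
    have h2 : (1 + Real.log ((n + 1 : ℕ) : ℝ)) ^ 2 ≤ (4 * Real.log n) ^ 2 := by
      refine pow_le_pow_left₀ (by linarith) ?_ 2
      linarith
    have h3 : (4 * Real.log n) ^ 2 ≤ 32 * Real.log n ^ 3 := by
      nlinarith [sq_nonneg (Real.log n)]
    have h4 : 2 ≤ 16 * Real.log n ^ 3 := by
      have := pow_le_pow_left₀ (by norm_num) hlog 3
      linarith
    have h5 : K * (1 + Real.log ((n + 1 : ℕ) : ℝ)) ^ 2 ≤ K * (32 * Real.log n ^ 3) := by
      gcongr
      exact h2.trans h3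
    linarith
  · intro hd5 n hn
    have hd5' : (5 : ℝ) ≤ d := by exact_mod_cast hd5
    have h := hbound n hn 4 (BoundaryRange.sum_rpow_neg_le_four (by linarith) (n + 1))
    linarith
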